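/- For $z\in\mathbb C$ let $\mathrm{ReLU}(z)=\max(0,\operatorname{Re}z)+\mathbf i\,\max(0,\operatorname{Im}z)$, applied coordinatewise to vectors of $\mathbb C^n$, and let $\|\cdot\|$ be the $\ell_2$ norm on $\mathbb C^n$. For $W\in\mathbb C^{n\times n}$ and $b\in\mathbb C^n$ put $f_{W,b}(x)=\mathrm{ReLU}(Wx+b)$. A deep ReLU network of width $n$ and depth $L$ is a map $\mathcal N=f_{W_L,b_L}\circ\dots\circ f_{W_1,b_1}$ with $W_i\in\mathbb C^{n\times n}$, $b_i\in\mathbb C^n$. A diagonal circulant neural network (DCNN) of width $n$ and depth $m$ is a composition of $m$ layers $x\mapsto\phi_i(D_iC_ix+b'_i)$ with $D_i\in\mathbb C^{n\times n}$ diagonal, $C_i\in\mathbb C^{n\times n}$ circulant, $b'_i\in\mathbb C^n$, and each $\phi_i$ the ReLU or the identity. Let $\mathcal N=f_{W_L,b_L}\circ\dots\circ f_{W_1,b_1}$ be any deep ReLU network of depth $L$ and width $n$, let $\sigma_{i,j}$ be the $j$-th largest singular value of $W_i$, and let $\sigma_{\max,j}=\max_i\sigma_{i,j}$. Let $\mathcal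 X\subset\mathbb C^n$ be bounded and let $k$ be a positive integer dividing $n$. Then there is a DCNN $\mathcal N'=f_{D_mC_m,b'_m}\circ\dots\circ f_{D_1C_1,b'_1}$ of width $n$ and depth $m=L(4k+1)$, all of whose activations are ReLU, such that for all $x\in\mathcal X$ $$\|\mathcal N(x)-\mathcal N'(x)\|\le\frac{(\sigma_{\max,1}^L-1)\,R\,\sigma_{\max,k}}{\sigma_{\max,1}-1}.$$ Here $R$ is any upper bound on the norms of the input and of the outputs of all layers of $\mathcal N$ on $\mathcal X$: $\|x_i\|\le R$ for all $x_0\in\mathcal X$ and $0\le i\le L$, where $x_i=f_{W_i,b_i}(x_{i-1})$. If $\sigma_{\max,1}=1$, the quotient $(\sigma_{\max,1}^L-1)/(\sigma_{\max,1}-1)$ is read as its limit $L$. -/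

import Mathlib

/-- `ℂⁿ` with the `ℓ²` norm. -/
abbrev CVec (n : ℕ) : Type := EuclideanSpace ℂ (Fin n)

/-- The ReLU on complex numbers: `ReLU(Re z) + i ReLU(Im z)`. -/
noncomputable def complexReLU (z : ℂ) : ℂ :=
  ⟨max 0 z.re, max 0 z.im⟩

/-- The two activations allowed in a diagonal circulant network. -/
inductive Activation where
  | relu
  | ident

/-- The action of an activation on a complex number. -/
noncomputable def Activation.apply : Activation → ℂ → ℂ
  | .relu => complexReLU
  | .ident => id

/-- The layer `x ↦ φ (W x + b)`, where the activation `φ` acts coordinatewise. -/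
noncomputable def affineLayer {n : ℕ} (φ : Activation) (W : Matrix (Fin n) (Fin n) ℂ)
    (b : CVec n) (x : CVec n) : CVec n :=
  WithLp.toLp 2 fun i => φ.apply ((Matrix.toEuclideanLin W x + b) i)

/-- The successive vectors `x₀ = x`, `xᵢ₊₁ = fᵢ xᵢ` (`i < L`). -/
def iterateLayers {E : Type*} {L : ℕ} (f : Fin L → E → E) (x : E) : Fin (L + 1) → E :=
  Fin.induction x fun i y => f i y

/-- A deep ReLU network of width `n` and depth `L`: weight matrices and biases. -/
structure ReLUNetwork (n L : ℕ) where
  /-- weight matrices -/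
  W : Fin L → Matrix (Fin n) (Fin n) ℂ
  /-- biases -/
  b : Fin L → CVec n

namespace ReLUNetwork

variable {n L : ℕ}

/-- `N.output x 0 = x` is the input, and `N.output x i` is the output of the `i`-th layer
(`1 ≤ i ≤ L`) on the input `x`. -/
noncomputable def output (N : ReLUNetwork n L) (x : CVec n) : Fin (L + 1) → CVec n :=
  iterateLayers (fun i => affineLayer .relu (N.W i) (N.b i)) x

/-- The function computed by the network. -/
noncomputable def eval (N : ReLUNetwork n L) (x : CVec n) : CVec n :=
  N.output x (Fin.last L)

/-- `N.sigma i j` is the `j`-th largest singular value of the `i`-th weight matrix, `j = 1, 2, …`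
(Mathlib's sequence of singular values starts at index `0`). -/
noncomputable def sigma (N : ReLUNetwork n L) (i : Fin L) (j : ℕ) : ℝ :=
  (Matrix.toEuclideanLin (N.W i)).singularValues (j - 1)

/-- The maximum over all layers of the `j`-th largest singular value, `j = 1, 2, …`. -/
noncomputable def sigmaMax (N : ReLUNetwork n L) (j : ℕ) : ℝ :=
  ⨆ i : Fin L, N.sigma i j

end ReLUNetwork

/-- A diagonal circulant neural network of width `n` and depth `m`. -/
structure DCNN (n m : ℕ) where
  /-- diagonal factors -/
  D : Fin m → Matrix (Fin n) (Fin n) ℂ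
  /-- circulant factors -/
  C : Fin m → Matrix (Fin n) (Fin n) ℂ
  /-- biases -/
  b : Fin m → CVec n
  /-- activations -/
  act : Fin m → Activation
  isDiag : ∀ i, (D i).IsDiag
  isCirculant : ∀ i, ∃ c : Fin n → ℂ, C i = Matrix.circulant c

/-- The function computed by the network, with layers `x ↦ φᵢ (Dᵢ Cᵢ x + bᵢ)`. -/
noncomputable def DCNN.eval {n m : ℕ} (N : DCNN n m) (x : CVec n) : CVec n :=
  iterateLayers (fun i => affineLayer (N.act i) (N.D i * N.C i) (N.b i)) x (Fin.last m)

/-! Replace each `W i` by its rank-`k` singular value truncation `U diag(s) Vᵀ`. This costs at most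
`σ_max,k ‖x‖` per layer and does not raise the operator norm, so the error obeys `eᵢ₊₁ ≤ σ_max,k R +
σ_max,1 eᵢ` and sums to the stated geometric series (`ReLUNetwork.norm_eval_sub_eval_le`).

The algebraic core is that every such truncation is a product of `4k + 1` factors `D C`
(`mul_diagonal_mul_transpose_mem_pow`). Write `U = F E` and `V = G E` with `E` the first `k` columns
of the identity; then `U diag(s) Vᵀ = F (E diag(s) Eᵀ) Gᵀ` has a diagonal middle factor. To find
`F`, use band matrices `∑_{i<k} diag(cᵢ) Sⁱ` in the cyclic shift `S`. Row `r` of a band matrix times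
`U` sees only the `k` cyclically consecutive rows of `U` from `r` on. After multiplying `U` and `E`
by suitable circulants, all these windows are invertible, so each band matrix `A` has a band matrix
`B` with `A C₀ U = B C₁ E`, the coefficients of `B` being a linear bijective function of those of
`A`.

A generic band matrix factors as `(1 + diag(p_{k-1}) S) ⋯ (1 + diag(p₁) S) diag(p₀)`: both sides
have `kn` parameters and the product map is dominant, hence surjective off a hypersurface. Each
linear factor with nonvanishing `p` is diagonally similar to a circulant. Choosing `A` generic makes
both `A` and `B` alternating products.

Finally, on a bounded set large biases turn the intermediate ReLUs into identities, so a product of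
`D C` factors is realized exactly by successive ReLU layers (`IsDCNNOn.affineLayer`). -/

section

/-! ### Dominant polynomial maps hit a generic point -/

open MvPolynomial

/-- An integral extension of `A` maps to an algebraically closed field over any given point. -/
theorem exists_ringHom_extending_of_isIntegral {A B K : Type*} [CommRing A] [CommRing B]
    [Field K] [IsAlgClosed K] [Algebra A B] [Algebra.IsIntegral A B]
    (hinj : Function.Injective (algebraMap A B)) (φ : A →+* K) (hφ : Function.Surjective φ) :
    ∃ χ : B →+* K, χ.comp (algebraMap A B) = φ := by
  have hm : (RingHom.ker φ).IsMaximal := RingHom.ker_isMaximal_of_surjective φ hφ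
  obtain ⟨Q, hQ, hQm⟩ := Ideal.exists_ideal_over_maximal_of_isIntegral (S := B) (RingHom.ker φ)
    (by rw [(RingHom.injective_iff_ker_eq_bot _).1 hinj]; exact bot_le)
  let ψ : K →+* B ⧸ Q := RingHom.liftOfSurjective φ hφ
    ⟨(Ideal.Quotient.mk Q).comp (algebraMap A B), by
      intro a ha
      rw [← hQm] at ha
      exact Ideal.Quotient.eq_zero_iff_mem.2 ha⟩
  have hψ : ψ.comp φ = (Ideal.Quotient.mk Q).comp (algebraMap A B) :=
    RingHom.liftOfRightInverse_comp _ _ _ _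
  have hint : ψ.IsIntegral := by
    intro z
    obtain ⟨b, rfl⟩ := Ideal.Quotient.mk_surjective z
    obtain ⟨p, hp, hpb⟩ := Algebra.IsIntegral.isIntegral (R := A) b
    refine ⟨p.map φ, hp.map φ, ?_⟩
    rw [Polynomial.eval₂_map, hψ, ← Polynomial.hom_eval₂, hpb, map_zero]
  have hbij : Function.Bijective ψ := by
    let _ := Ideal.Quotient.field Q
    -- `B ⧸ Q` is an integral extension of the algebraically closed field `K`, hence equal to it.
    exact IsAlgClosed.ringHom_bijective_of_isIntegral ψ hint
  let e := RingEquiv.ofBijective ψ hbij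
  refine ⟨(e.symm : (B ⧸ Q) →+* K).comp (Ideal.Quotient.mk Q), ?_⟩
  rw [RingHom.comp_assoc, ← hψ]
  ext a
  exact e.symm_apply_apply (φ a)

/-- If `K[X₁, …, Xₙ]` is algebraic over a subring `A`, then almost every `K`-point of `A` lifts to
a point of affine space. -/
theorem exists_ne_zero_forall_ringHom_exists_eval_eq {ι A K : Type*} [Fintype ι] [Field K]
    [IsAlgClosed K] [CommRing A] [IsDomain A] [Algebra A (MvPolynomial ι K)]
    [Algebra.IsAlgebraic A (MvPolynomial ι K)]
    (hinj : Function.Injective (algebraMap A (MvPolynomial ι K))) :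
    ∃ v : A, v ≠ 0 ∧ ∀ φ : A →+* K,
      (∀ a : K, ∃ c : A, algebraMap A (MvPolynomial ι K) c = C a ∧ φ c = a) → φ v ≠ 0 →
      ∃ x : ι → K, ∀ c : A, eval x (algebraMap A (MvPolynomial ι K) c) = φ c := by
  classical
  -- `v` is a common denominator: every `v • X i` is integral over `A`.
  obtain ⟨v, hv, hint⟩ := Algebra.IsAlgebraic.exists_integral_multiples A
    (Finset.univ.image (X : ι → MvPolynomial ι K))
  refine ⟨v, hv, fun φ hφ hφv => ?_⟩
  obtain ⟨χ, hχ⟩ := exists_ringHom_extending_of_isIntegral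
    (A := A) (B := integralClosure A (MvPolynomial ι K))
    (fun a b hab => hinj (congrArg
      (fun z : integralClosure A (MvPolynomial ι K) => (z : MvPolynomial ι K)) hab))
    φ (fun a => (hφ a).imp fun c hc => hc.2)
  have hχa : ∀ a : A, χ (algebraMap A _ a) = φ a := fun a => by rw [← hχ]; rfl
  let z : ι → integralClosure A (MvPolynomial ι K) := fun i =>
    ⟨v • X i, hint _ (Finset.mem_image_of_mem _ (Finset.mem_univ i))⟩
  let x : ι → K := fun i => χ (z i) / φ v
  -- Clearing denominators shows that `χ` acts as evaluation at `x`; for `g` from `A`, cancelling `φ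
  -- v ^ N` gives the claim.
  have key : ∀ g : MvPolynomial ι K, ∃ (N : ℕ) (h : integralClosure A (MvPolynomial ι K)),
      (h : MvPolynomial ι K) = v ^ N • g ∧ χ h = φ v ^ N * eval x g := by
    intro g
    induction g using MvPolynomial.induction_on with
    | C a =>
      obtain ⟨c, hc, hca⟩ := hφ a
      refine ⟨0, algebraMap A _ c, ?_, ?_⟩
      · rw [pow_zero, one_smul, ← hc]; rfl
      · rw [hχa, hca]; simp
    | add p q hp hq =>
      obtain ⟨N, h, h1, h2⟩ := hp
      obtain ⟨N', h', h1', h2'⟩ := hq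
      refine ⟨N + N', v ^ N' • h + v ^ N • h', ?_, ?_⟩
      · push_cast
        rw [h1, h1', smul_smul, smul_smul, ← pow_add, ← pow_add, smul_add, add_comm N' N]
      · rw [map_add, Algebra.smul_def, Algebra.smul_def, map_mul, map_mul, hχa, hχa, h2, h2']
        simp only [map_pow, map_add]
        ring
    | mul_X p i hp =>
      obtain ⟨N, h, h1, h2⟩ := hp
      refine ⟨N + 1, h * z i, ?_, ?_⟩
      · push_cast
        rw [h1, pow_succ]
        simp only [z, Algebra.smul_def, map_mul]
        ring
      · have hz : χ (z i) = x i * φ v := (div_mul_cancel₀ _ hφv).symm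
        rw [map_mul, h2, hz, map_mul, eval_X]
        ring
  refine ⟨x, fun c => ?_⟩
  obtain ⟨N, h, h1, h2⟩ := key (algebraMap A _ c)
  have h3 : h = algebraMap A _ (v ^ N * c) := by
    apply Subtype.ext
    rw [h1, Algebra.smul_def, ← map_mul]
    rfl
  rw [h3, hχa, map_mul, map_pow] at h2
  exact (mul_left_cancel₀ (pow_ne_zero N hφv) h2).symm

/-- A polynomial map between affine spaces of the same dimension whose components are
algebraically independent is surjective over the complement of a hypersurface. -/
theorem exists_ne_zero_forall_eval_ne_zero_exists_eval_eq {ι K : Type*} [Fintype ι] [Field K]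
    [IsAlgClosed K] {f : ι → MvPolynomial ι K} (hf : AlgebraicIndependent K f) :
    ∃ u : MvPolynomial ι K, u ≠ 0 ∧
      ∀ y : ι → K, eval y u ≠ 0 → ∃ x : ι → K, ∀ i, eval x (f i) = y i := by
  -- As many independent elements as the transcendence degree: the polynomial ring is algebraic over
  -- `K[f]`.
  have hb : IsTranscendenceBasis K f :=
    hf.isTranscendenceBasis_of_lift_trdeg_le_of_finite
      (by rw [MvPolynomial.trdeg_of_isDomain]; simp)
  have := hb.isAlgebraic
  obtain ⟨v, hv, h⟩ := exists_ne_zero_forall_ringHom_exists_eval_eq (ι := ι) (K := K)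
    (A := Algebra.adjoin K (Set.range f)) Subtype.val_injective
  let e := hf.aevalEquiv
  refine ⟨e.symm v, by simpa using hv, fun y hy => ?_⟩
  obtain ⟨x, hx⟩ := h ((eval y).comp (e.symm : _ →+* MvPolynomial ι K))
    (fun a => ⟨algebraMap K _ a, rfl, by simp⟩) hy
  refine ⟨x, fun i => ?_⟩
  have h4 : e.symm ⟨f i, Algebra.subset_adjoin ⟨i, rfl⟩⟩ = X i := by
    rw [AlgEquiv.symm_apply_eq]
    apply Subtype.ext
    simp [e]
  refine (hx ⟨f i, Algebra.subset_adjoin ⟨i, rfl⟩⟩).trans ?_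
  simp [h4]

/-! ### Products of linear factors in the cyclic shift are generic -/

/-- The coefficients of `(1 + diag(b) S) ∑ᵢ diag(cᵢ) Sⁱ`, where `S` is the cyclic shift. -/
def mulLinearCoeff {n : ℕ} [NeZero n] {R : Type*} [CommRing R] (b : Fin n → R)
    (c : ℕ → Fin n → R) : ℕ → Fin n → R
  | 0 => c 0
  | i + 1 => fun r => c (i + 1) r + b r * c i (r + 1)

/-- The coefficients of `(1 + diag(pⱼ) S) ⋯ (1 + diag(p₁) S) diag(p₀)`. -/
def linearProdCoeff {n : ℕ} [NeZero n] {R : Type*} [CommRing R] (p : ℕ → Fin n → R) :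
    ℕ → ℕ → Fin n → R
  | 0 => fun i => if i = 0 then p 0 else 0
  | j + 1 => mulLinearCoeff (p (j + 1)) (linearProdCoeff p j)

theorem map_mulLinearCoeff {n : ℕ} [NeZero n] {R S : Type*} [CommRing R] [CommRing S]
    (φ : R →+* S) (b : Fin n → R) (c : ℕ → Fin n → R) (i : ℕ) (r : Fin n) :
    φ (mulLinearCoeff b c i r) =
      mulLinearCoeff (fun r => φ (b r)) (fun i r => φ (c i r)) i r := by
  cases i <;> simp [mulLinearCoeff]

theorem map_linearProdCoeff {n : ℕ} [NeZero n] {R S : Type*} [CommRing R] [CommRing S]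
    (φ : R →+* S) (p : ℕ → Fin n → R) (j i : ℕ) (r : Fin n) :
    φ (linearProdCoeff p j i r) = linearProdCoeff (fun i r => φ (p i r)) j i r := by
  induction j generalizing i r with
  | zero => by_cases h : i = 0 <;> simp [linearProdCoeff, h]
  | succ j ih =>
    simp only [linearProdCoeff, map_mulLinearCoeff]
    congr 1
    funext i r
    exact ih i r

theorem linearProdCoeff_eq_zero {n : ℕ} [NeZero n] {R : Type*} [CommRing R] (p : ℕ → Fin n → R)
    {j i : ℕ} (h : j < i) : linearProdCoeff p j i = 0 := by
  induction j generalizing i with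
  | zero => simp [linearProdCoeff, h.ne']
  | succ j ih =>
    obtain ⟨i, rfl⟩ : ∃ i', i = i' + 1 := ⟨i - 1, by omega⟩
    funext r
    simp [linearProdCoeff, mulLinearCoeff, ih (i := i + 1) (by omega), ih (i := i) (by omega)]

theorem linearProdCoeff_congr {n : ℕ} [NeZero n] {R : Type*} [CommRing R] {p q : ℕ → Fin n → R}
    {j : ℕ} (h : ∀ i ≤ j, p i = q i) : linearProdCoeff p j = linearProdCoeff q j := by
  induction j with
  | zero => simp [linearProdCoeff, h 0 le_rfl]
  | succ j ih =>
    simp only [linearProdCoeff]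
    rw [ih fun i hi => h i (by omega), h (j + 1) le_rfl]

/-- A polynomial vanishing on all curves `s ↦ (sʷ)⁻¹ (s c + e)` vanishes, if each point `e` with
nonzero coordinates admits such a curve. -/
theorem eq_zero_of_eval_curve_eq_zero {ι : Type*} [Fintype ι] (w : ι → ℕ)
    (P : MvPolynomial ι ℂ)
    (h : ∀ e : ι → ℂ, (∀ i, e i ≠ 0) → ∃ c : ι → ℂ, ∀ s : ℂ, s ≠ 0 →
      eval (fun i => (s ^ w i)⁻¹ * (s * c i + e i)) P = 0) : P = 0 := by
  classical
  by_contra hP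
  let wt : (ι →₀ ℕ) → ℕ := fun m => ∑ i, w i * m i
  obtain ⟨m₀, hm₀, hD⟩ := Finset.exists_mem_eq_sup P.support (support_nonempty.2 hP) wt
  set D := P.support.sup wt
  -- The part of `P` of top weight. Multiplied by `s ^ D`, `P` on the curve extends continuously to
  -- `s = 0` with value `T` at `e`, so `T` vanishes wherever no coordinate does.
  let T : MvPolynomial ι ℂ := ∑ m ∈ P.support with wt m = D, monomial m (P.coeff m)
  have hT : T = 0 := by
    refine MvPolynomial.funext_set (fun _ => {z : ℂ | z ≠ 0})
      (fun _ => (Set.finite_singleton (0 : ℂ)).infinite_compl) (fun e he => ?_)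
    have he' : ∀ i, e i ≠ 0 := fun i => he i (Set.mem_univ i)
    obtain ⟨c, hc⟩ := h e he'
    let H : ℂ → ℂ := fun s =>
      ∑ m ∈ P.support, P.coeff m * s ^ (D - wt m) * ∏ i, (s * c i + e i) ^ m i
    have hcont : Continuous H := by fun_prop
    have hH : H = fun _ => 0 := by
      refine hcont.ext_on (dense_compl_singleton (0 : ℂ)) continuous_const fun s hs => ?_
      have hs : s ≠ 0 := hs
      have : H s = s ^ D * eval (fun i => (s ^ w i)⁻¹ * (s * c i + e i)) P := by
        rw [eval_eq', Finset.mul_sum]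
        refine Finset.sum_congr rfl fun m hm => ?_
        have hle : wt m ≤ D := Finset.le_sup hm
        simp only [mul_pow, Finset.prod_mul_distrib, inv_pow, ← pow_mul, Finset.prod_inv_distrib,
          Finset.prod_pow_eq_pow_sum]
        rw [pow_sub₀ _ hs hle]
        ring
      rw [this, hc s hs, mul_zero]
    have h0 : H 0 = eval e T := by
      simp only [H, T, map_sum, Finset.sum_filter]
      refine Finset.sum_congr rfl fun m hm => ?_
      have hle : wt m ≤ D := Finset.le_sup hm
      split_ifs with hw
      · rw [eval_monomial, Finsupp.prod_fintype _ _ fun i => pow_zero _]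
        simp [hw]
      · simp [Nat.sub_ne_zero_of_lt (lt_of_le_of_ne hle hw)]
    rw [← h0, hH, map_zero]
  have : coeff m₀ T = coeff m₀ P := by
    simp only [T, coeff_sum, coeff_monomial]
    rw [Finset.sum_ite_eq' , if_pos (by simp [hm₀, ← hD])]
  rw [hT, coeff_zero] at this
  exact mem_support_iff.1 hm₀ this.symm

/-- With `b` replaced by `s⁻¹ b`, coefficient `i + 1` becomes `s⁻¹ (s cᵢ₊₁(r) + b(r) cᵢ(r+1))`,
while coefficient `0` stays `c₀`. The leading terms can be given any nonzero values `e`, so the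
curve criterion applies with weights `0, 1, …, 1`. -/
theorem eq_zero_of_eval_mulLinearCoeff_eq_zero {n : ℕ} [NeZero n] {j : ℕ}
    (P : MvPolynomial (Fin (j + 2) × Fin n) ℂ)
    (h : ∀ (b : Fin n → ℂ) (c : ℕ → Fin n → ℂ), (∀ i, j < i → c i = 0) →
      eval (fun x => mulLinearCoeff b c x.1 x.2) P = 0) : P = 0 := by
  refine eq_zero_of_eval_curve_eq_zero (fun x => if (x.1 : ℕ) = 0 then 0 else 1) P fun e he => ?_
  let e' : ℕ → Fin n → ℂ := fun i r => if hi : i < j + 2 then e (⟨i, hi⟩, r) else 0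
  have he' : ∀ i, i < j + 2 → ∀ r, e' i r ≠ 0 := fun i hi r => by simp [e', hi, he]
  have hee : ∀ x : Fin (j + 2) × Fin n, e x = e' x.1 x.2 := fun x => by simp [e']
  let b : Fin n → ℂ := fun r => e' 1 r / e' 0 (r + 1)
  have hb : ∀ r, b r ≠ 0 := fun r => div_ne_zero (he' _ (by omega) _) (he' _ (by omega) _)
  let c : ℕ → Fin n → ℂ := fun i r => if i = 0 then e' 0 r else e' (i + 1) (r - 1) / b (r - 1)
  have hbc : ∀ i r, b r * c i (r + 1) = e' (i + 1) r := by
    intro i r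
    by_cases hi : i = 0
    · simp only [c, hi, if_true, b]
      exact div_mul_cancel₀ _ (he' 0 (by omega) _)
    · simp only [c, hi, if_false, add_sub_cancel_right]
      exact mul_div_cancel₀ _ (hb r)
  refine ⟨fun x => if (x.1 : ℕ) = 0 then 0 else c x.1 x.2, fun s hs => ?_⟩
  refine Eq.trans ?_ (h (fun r => s⁻¹ * b r) c ?_)
  · congr 1
    congr 1
    funext x
    obtain ⟨⟨i, hi⟩, r⟩ := x
    rw [hee]
    cases i with
    | zero => simp [mulLinearCoeff, c]
    | succ i =>
      simp only [mulLinearCoeff, mul_assoc, hbc]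
      simp
      field_simp
  · intro i hi
    funext r
    have : ¬ i + 1 < j + 2 := by omega
    have hi0 : i ≠ 0 := by omega
    simp only [c, e', dif_neg this, if_neg hi0, zero_div, Pi.zero_apply]

/-- The products of linear factors are Zariski dense among the band matrices. -/
theorem eq_zero_of_eval_linearProdCoeff_eq_zero {n : ℕ} [NeZero n] {j : ℕ}
    (P : MvPolynomial (Fin (j + 1) × Fin n) ℂ)
    (h : ∀ p : ℕ → Fin n → ℂ, eval (fun x => linearProdCoeff p j x.1 x.2) P = 0) : P = 0 := by
  induction j with
  | zero =>
    refine MvPolynomial.funext fun e => ?_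
    rw [map_zero]
    refine Eq.trans ?_ (h fun i r => e (0, r))
    congr 1
    congr 1
    funext x
    obtain ⟨i, r⟩ := x
    obtain rfl : i = 0 := Fin.ext (by omega)
    simp [linearProdCoeff]
  | succ j ih =>
    refine eq_zero_of_eval_mulLinearCoeff_eq_zero P fun b c hc => ?_
    -- For fixed `b`, the pullback of `P` along multiplication by `1 + diag(b) S`; induction kills
    -- it.
    let Q : MvPolynomial (Fin (j + 1) × Fin n) ℂ :=
      aeval (fun x : Fin (j + 2) × Fin n => mulLinearCoeff (fun r => C (b r))
        (fun i r => if hi : i < j + 1 then X (⟨i, hi⟩, r) else 0) x.1 x.2) P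
    have hQ : ∀ c : ℕ → Fin n → ℂ, (∀ i, j < i → c i = 0) →
        eval (fun x => c x.1 x.2) Q = eval (fun x => mulLinearCoeff b c x.1 x.2) P := by
      intro c hc
      simp only [Q]
      rw [aeval_def, algebraMap_eq, eval_eval₂]
      simp only [map_mulLinearCoeff, eval_C]
      rw [← eval₂_id]
      congr 1
      · ext; simp
      · funext x
        congr 1
        funext i r
        split_ifs with hi
        · simp
        · simp [hc i (by omega)]
    rw [← hQ c hc, ih Q fun p => ?_, map_zero]
    rw [hQ _ fun i hi => linearProdCoeff_eq_zero p hi, ← h (Function.update p (j + 1) b)]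
    simp only [linearProdCoeff, Function.update_self]
    rw [linearProdCoeff_congr (j := j) (p := Function.update p (j + 1) b) (q := p)]
    intro i hi
    exact Function.update_of_ne (by omega) _ _

/-- Almost every band matrix is a product of linear factors. -/
theorem exists_ne_zero_forall_exists_linearProdCoeff_eq (n : ℕ) [NeZero n] (j : ℕ) :
    ∃ u : MvPolynomial (Fin (j + 1) × Fin n) ℂ, u ≠ 0 ∧
      ∀ y : Fin (j + 1) × Fin n → ℂ, eval y u ≠ 0 →
        ∃ p : ℕ → Fin n → ℂ, ∀ x, linearProdCoeff p j x.1 x.2 = y x := by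
  let g : ℕ → Fin n → MvPolynomial (Fin (j + 1) × Fin n) ℂ := fun i r =>
    if hi : i < j + 1 then X (⟨i, hi⟩, r) else 0
  have heval : ∀ (z : Fin (j + 1) × Fin n → ℂ) (x : Fin (j + 1) × Fin n),
      eval z (linearProdCoeff g j x.1 x.2) =
        linearProdCoeff (fun i r => eval z (g i r)) j x.1 x.2 := fun z x =>
    map_linearProdCoeff (eval z) g j _ _
  have hind : AlgebraicIndependent ℂ
      (fun x : Fin (j + 1) × Fin n => linearProdCoeff g j x.1 x.2) := by
    rw [algebraicIndependent_iff]
    intro P hP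
    refine eq_zero_of_eval_linearProdCoeff_eq_zero P fun p => ?_
    have := congrArg (eval fun x => p x.1 x.2) hP
    rw [map_zero, aeval_def, algebraMap_eq, eval_eval₂] at this
    rw [← this, ← eval₂_id]
    congr 1
    · ext; simp
    · funext x
      rw [heval]
      refine congrFun (congrFun (linearProdCoeff_congr ?_) _) _
      intro i hi
      funext r
      simp [g, hi]
  obtain ⟨u, hu, h⟩ := exists_ne_zero_forall_eval_ne_zero_exists_eval_eq hind
  refine ⟨u, hu, fun y hy => ?_⟩
  obtain ⟨z, hz⟩ := h y hy
  exact ⟨_, fun x => (heval z x).symm.trans (hz x)⟩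

end

/-! ### Alternating products of diagonal and circulant matrices -/

section

open scoped Pointwise

theorem Fin.val_nsmul_one {n : ℕ} [NeZero n] (t : ℕ) : ((t • (1 : Fin n) : Fin n) : ℕ) = t % n := by
  induction t with
  | zero => simp
  | succ t ih => rw [succ_nsmul, Fin.val_add, ih, Fin.val_one']; simp

theorem Fin.val_nsmul_one_self {n : ℕ} [NeZero n] (s : Fin n) : (s : ℕ) • (1 : Fin n) = s :=
  Fin.ext (by rw [Fin.val_nsmul_one, Nat.mod_eq_of_lt s.isLt])

/-- The set of diagonal matrices. -/
def diagonalMatrices (n : ℕ) : Set (Matrix (Fin n) (Fin n) ℂ) := {M | M.IsDiag}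

/-- The set of circulant matrices. -/
def circulantMatrices (n : ℕ) : Set (Matrix (Fin n) (Fin n) ℂ) :=
  {M | ∃ c : Fin n → ℂ, M = Matrix.circulant c}

theorem diagonal_mem_diagonalMatrices {n : ℕ} (d : Fin n → ℂ) :
    Matrix.diagonal d ∈ diagonalMatrices n := Matrix.isDiag_diagonal d

theorem one_mem_diagonalMatrices (n : ℕ) : (1 : Matrix (Fin n) (Fin n) ℂ) ∈ diagonalMatrices n :=
  Matrix.isDiag_one

theorem one_mem_circulantMatrices (n : ℕ) :
    (1 : Matrix (Fin n) (Fin n) ℂ) ∈ circulantMatrices n :=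
  ⟨_, (Matrix.Fin.circulant_ite ℂ n).symm⟩

theorem diagonalMatrices_mul_self (n : ℕ) :
    diagonalMatrices n * diagonalMatrices n = diagonalMatrices n := by
  apply Set.Subset.antisymm
  · rintro _ ⟨A, hA, B, hB, rfl⟩
    change (A * B).IsDiag
    rw [← hA.diagonal_diag, ← hB.diagonal_diag, Matrix.diagonal_mul_diagonal]
    exact Matrix.isDiag_diagonal _
  · intro A hA
    exact ⟨A, hA, 1, one_mem_diagonalMatrices n, mul_one A⟩

theorem inv_mem_diagonalMatrices {n : ℕ} {M : Matrix (Fin n) (Fin n) ℂ}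
    (hM : M ∈ diagonalMatrices n) : M⁻¹ ∈ diagonalMatrices n := by
  have hM : M.IsDiag := hM
  change M⁻¹.IsDiag
  rw [← hM.diagonal_diag, Matrix.inv_diagonal]
  exact Matrix.isDiag_diagonal _

theorem transpose_mem_diagonalMatrices {n : ℕ} {M : Matrix (Fin n) (Fin n) ℂ}
    (hM : M ∈ diagonalMatrices n) : M.transpose ∈ diagonalMatrices n :=
  Matrix.IsDiag.transpose hM

theorem transpose_mem_circulantMatrices {n : ℕ} {M : Matrix (Fin n) (Fin n) ℂ}
    (hM : M ∈ circulantMatrices n) : M.transpose ∈ circulantMatrices n := by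
  obtain ⟨c, rfl⟩ := hM
  exact ⟨_, Matrix.Fin.transpose_circulant c⟩

/-- The cyclic shift matrix `(S x)ᵣ = xᵣ₊₁`. -/
def cyclicShift (n : ℕ) [NeZero n] : Matrix (Fin n) (Fin n) ℂ :=
  Matrix.of fun r s => if s = r + 1 then 1 else 0

theorem cyclicShift_mul_apply {n : ℕ} [NeZero n] {m : Type*} (U : Matrix (Fin n) m ℂ)
    (r : Fin n) (l : m) : (cyclicShift n * U) r l = U (r + 1) l := by
  simp [cyclicShift, Matrix.mul_apply]

theorem mul_cyclicShift_apply {n : ℕ} [NeZero n] {m : Type*} (U : Matrix m (Fin n) ℂ)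
    (l : m) (s : Fin n) : (U * cyclicShift n) l (s + 1) = U l s := by
  simp [cyclicShift, Matrix.mul_apply]

theorem cyclicShift_pow_mul_apply {n : ℕ} [NeZero n] {m : Type*} (i : ℕ) (U : Matrix (Fin n) m ℂ)
    (r : Fin n) (l : m) : (cyclicShift n ^ i * U) r l = U (r + i • 1) l := by
  induction i generalizing r with
  | zero => simp
  | succ i ih =>
    rw [pow_succ', Matrix.mul_assoc, cyclicShift_mul_apply, ih, succ_nsmul', add_assoc]

/-- The commutation form makes closure under inversion and membership of `1 + βS` immediate. -/
theorem mem_circulantMatrices_iff_commute {n : ℕ} [NeZero n] (M : Matrix (Fin n) (Fin n) ℂ) :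
    M ∈ circulantMatrices n ↔ Commute (cyclicShift n) M := by
  constructor
  · rintro ⟨c, rfl⟩
    ext r s
    obtain ⟨s, rfl⟩ : ∃ s', s = s' + 1 := ⟨s - 1, by simp⟩
    rw [cyclicShift_mul_apply, mul_cyclicShift_apply]
    simp [Matrix.circulant_apply]
  · intro h
    have h1 : ∀ r s, M (r + 1) (s + 1) = M r s := fun r s => by
      rw [← cyclicShift_mul_apply M, h.eq, mul_cyclicShift_apply]
    have h2 : ∀ (t : ℕ) r s, M (r + t • 1) (s + t • 1) = M r s := by
      intro t
      induction t with
      | zero => simp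
      | succ t ih =>
        intro r s
        rw [succ_nsmul, ← add_assoc, ← add_assoc, h1, ih]
    refine ⟨fun i => M i 0, ?_⟩
    ext r s
    have := h2 s (r - s) 0
    rw [Fin.val_nsmul_one_self, sub_add_cancel, zero_add] at this
    rw [Matrix.circulant_apply, this]

theorem inv_mem_circulantMatrices {n : ℕ} {M : Matrix (Fin n) (Fin n) ℂ}
    (hM : M ∈ circulantMatrices n) (hdet : IsUnit M) : M⁻¹ ∈ circulantMatrices n := by
  obtain rfl | hn := Nat.eq_zero_or_pos n
  · exact ⟨fun _ => 0, Subsingleton.elim _ _⟩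
  have : NeZero n := ⟨hn.ne'⟩
  rw [mem_circulantMatrices_iff_commute] at hM ⊢
  have hu := (Matrix.isUnit_iff_isUnit_det _).1 hdet
  calc cyclicShift n * M⁻¹ = M⁻¹ * (M * cyclicShift n) * M⁻¹ := by
        rw [← mul_assoc, Matrix.nonsing_inv_mul _ hu, one_mul]
    _ = M⁻¹ * cyclicShift n := by
        rw [← hM.eq, mul_assoc, mul_assoc, Matrix.mul_nonsing_inv _ hu, mul_one]

/-- The alternating products `D₀ C₁ D₁ ⋯ Cⱼ Dⱼ` are closed under inversion. -/
theorem inv_mem_diagonal_mul_pow {n : ℕ} {j : ℕ} {M : Matrix (Fin n) (Fin n) ℂ}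
    (hM : M ∈ diagonalMatrices n * (circulantMatrices n * diagonalMatrices n) ^ j)
    (hu : IsUnit M) :
    M⁻¹ ∈ diagonalMatrices n * (circulantMatrices n * diagonalMatrices n) ^ j := by
  induction j generalizing M with
  | zero =>
    rw [pow_zero, mul_one] at hM ⊢
    exact inv_mem_diagonalMatrices hM
  | succ j ih =>
    rw [pow_succ', mul_assoc (circulantMatrices n)] at hM
    obtain ⟨D, hD, _, ⟨C, hC, M', hM', rfl⟩, rfl⟩ := hM
    simp only [Matrix.isUnit_iff_isUnit_det, IsUnit.mul_iff] at hu
    simp only [← Matrix.isUnit_iff_isUnit_det] at hu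
    rw [pow_succ, ← mul_assoc]
    simp only [Matrix.mul_inv_rev]
    rw [Matrix.mul_assoc]
    exact Set.mul_mem_mul (ih hM' hu.2.2)
      (Set.mul_mem_mul (inv_mem_circulantMatrices hC hu.2.1) (inv_mem_diagonalMatrices hD))

theorem transpose_mem_pow {n : ℕ} {A B : Set (Matrix (Fin n) (Fin n) ℂ)}
    (hA : ∀ M ∈ A, M.transpose ∈ A) (hB : ∀ M ∈ B, M.transpose ∈ B) {j : ℕ}
    {M : Matrix (Fin n) (Fin n) ℂ} (hM : M ∈ (A * B) ^ j) : M.transpose ∈ (B * A) ^ j := by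
  induction j generalizing M with
  | zero =>
    rw [pow_zero, Set.mem_one] at hM ⊢
    rw [hM, Matrix.transpose_one]
  | succ j ih =>
    rw [pow_succ'] at hM
    obtain ⟨_, ⟨a, ha, b, hb, rfl⟩, M', hM', rfl⟩ := hM
    rw [pow_succ]
    simp only [Matrix.transpose_mul]
    exact Set.mul_mem_mul (ih hM') (Set.mul_mem_mul (hB _ hb) (hA _ ha))

/-- A bidiagonal cyclic matrix is similar to a circulant one by a diagonal matrix. -/
theorem one_add_diagonal_mul_cyclicShift_mem {n : ℕ} [NeZero n] {b : Fin n → ℂ}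
    (hb : ∀ r, b r ≠ 0) :
    1 + Matrix.diagonal b * cyclicShift n ∈
      diagonalMatrices n * (circulantMatrices n * diagonalMatrices n) := by
  have hn : n ≠ 0 := NeZero.ne n
  obtain ⟨β, hβ⟩ := IsAlgClosed.exists_pow_nat_eq (∏ r, b r) (Nat.pos_of_ne_zero hn)
  have hprod : ∏ r, b r ≠ 0 := Finset.prod_ne_zero_iff.2 fun r _ => hb r
  have hβ0 : β ≠ 0 := by
    rintro rfl
    rw [zero_pow hn] at hβ
    exact hprod hβ.symm
  -- Solves the recursion `d(r+1) b(r) = β d(r)` for the diagonal conjugation to `1 + βS`; the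
  -- choice `βⁿ = ∏ b` makes the solution `n`-periodic.
  let g : ℕ → ℂ := fun t => β ^ t / ∏ i ∈ Finset.range t, b (i • 1)
  have hg0 : ∀ t, g t ≠ 0 := fun t =>
    div_ne_zero (pow_ne_zero _ hβ0) (Finset.prod_ne_zero_iff.2 fun i _ => hb _)
  have hgs : ∀ t, g (t + 1) * b (t • 1) = β * g t := by
    intro t
    have h1 : ∏ i ∈ Finset.range t, b (i • 1) ≠ 0 := Finset.prod_ne_zero_iff.2 fun i _ => hb _
    have h2 := hb (t • 1)
    simp only [g, Finset.prod_range_succ, pow_succ]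
    field_simp
  have hgn : g n = 1 := by
    have : ∏ i ∈ Finset.range n, b (i • 1) = ∏ r, b r := by
      rw [Finset.prod_range]
      exact Finset.prod_congr rfl fun r _ => by rw [Fin.val_nsmul_one_self]
    simp only [g, this, hβ, div_self hprod]
  let d : Fin n → ℂ := fun r => g r
  have hd : ∀ r : Fin n, d (r + 1) * b r = β * d r := by
    intro r
    have h1 : d (r + 1) = g (r + 1) := by
      have hv : ((r + 1 : Fin n) : ℕ) = (r + 1) % n := by
        rw [Fin.val_add, Fin.val_one']; simp
      simp only [d, hv]
      rcases (Nat.succ_le_of_lt r.isLt).lt_or_eq with h | h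
      · rw [Nat.mod_eq_of_lt h]
      · have h : (r : ℕ) + 1 = n := h
        rw [h, Nat.mod_self, hgn]
        simp [g]
    have := hgs r
    rw [Fin.val_nsmul_one_self] at this
    rw [h1, this]
  have hd0 : ∀ r, d r ≠ 0 := fun r => hg0 r
  refine ⟨Matrix.diagonal d, diagonal_mem_diagonalMatrices _, _,
    ⟨1 + β • cyclicShift n, ?_, Matrix.diagonal fun r => (d r)⁻¹,
      diagonal_mem_diagonalMatrices _, rfl⟩, ?_⟩
  · rw [mem_circulantMatrices_iff_commute]
    exact (Commute.one_right _).add_right ((Commute.refl _).smul_right _)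
  · ext r s
    simp only [Matrix.mul_diagonal, Matrix.diagonal_mul, Matrix.add_apply, Matrix.smul_apply,
      Matrix.one_apply, cyclicShift, Matrix.of_apply, smul_eq_mul]
    by_cases h1 : r = s <;> by_cases h2 : s = r + 1
    · have h3 := hd r
      rw [← h2, ← h1] at h3
      rw [if_pos h1, if_pos h2, ← h1]
      have := hd0 r
      have h4 : b r = β := mul_left_cancel₀ this (by rw [h3, mul_comm])
      rw [h4]
      field_simp
    · have := hd0 r
      rw [if_pos h1, if_neg h2, ← h1]
      field_simp
      ring
    · have := hd0 s
      rw [if_neg h1, if_pos h2]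
      have h3 := hd r
      rw [← h2] at h3
      field_simp
      linear_combination -h3
    · simp [h1, h2]

/-! ### Band matrices -/

/-- The matrix `∑ᵢ diag(cᵢ) Sⁱ` with `k` cyclic diagonals. -/
def bandMatrix {n : ℕ} [NeZero n] (k : ℕ) (c : ℕ → Fin n → ℂ) : Matrix (Fin n) (Fin n) ℂ :=
  ∑ i ∈ Finset.range k, Matrix.diagonal (c i) * cyclicShift n ^ i

theorem bandMatrix_mul_apply {n : ℕ} [NeZero n] {m : Type*} (k : ℕ) (c : ℕ → Fin n → ℂ)
    (U : Matrix (Fin n) m ℂ) (r : Fin n) (l : m) :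
    (bandMatrix k c * U) r l = ∑ i ∈ Finset.range k, c i r * U (r + i • 1) l := by
  rw [bandMatrix, Matrix.sum_mul, Matrix.sum_apply]
  refine Finset.sum_congr rfl fun i _ => ?_
  rw [Matrix.mul_assoc, Matrix.diagonal_mul, cyclicShift_pow_mul_apply]

/-- Rests on `S diag(c) = diag(c(· + 1)) S`. Since the top entry on the left involves `c (j + 1)`,
which the right side lacks, that coefficient must vanish. -/
theorem bandMatrix_mulLinearCoeff {n : ℕ} [NeZero n] (j : ℕ) (b : Fin n → ℂ)
    (c : ℕ → Fin n → ℂ) (hc : c (j + 1) = 0) :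
    bandMatrix (j + 2) (mulLinearCoeff b c) =
      (1 + Matrix.diagonal b * cyclicShift n) * bandMatrix (j + 1) c := by
  have key : ∀ (x y e : ℕ → ℂ) (b : ℂ), x (j + 1) = 0 →
      (∑ i ∈ Finset.range (j + 1), (x (i + 1) + b * y i) * e (i + 1)) + x 0 * e 0 =
        (∑ i ∈ Finset.range (j + 1), x i * e i) +
          b * ∑ i ∈ Finset.range (j + 1), y i * e (i + 1) := by
    intro x y e b hx
    have h1 := Finset.sum_range_succ' (fun i => x i * e i) (j + 1)
    rw [Finset.sum_range_succ, hx, zero_mul, add_zero] at h1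
    rw [h1, Finset.mul_sum, add_right_comm, ← Finset.sum_add_distrib]
    simp only [add_mul, mul_assoc]
  ext r s
  have h1 := bandMatrix_mul_apply (j + 2) (mulLinearCoeff b c) 1 r s
  have h2 := bandMatrix_mul_apply (j + 1) c 1 r s
  have h3 := bandMatrix_mul_apply (j + 1) c 1 (r + 1) s
  rw [Matrix.mul_one] at h1 h2 h3
  rw [add_mul, one_mul, Matrix.mul_assoc, Matrix.add_apply, Matrix.diagonal_mul,
    cyclicShift_mul_apply, h1, h2, h3, Finset.sum_range_succ']
  obtain ⟨e, he⟩ : ∃ e : Fin n → ℂ, ∀ t, (1 : Matrix (Fin n) (Fin n) ℂ) t s = e t :=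
    ⟨_, fun _ => rfl⟩
  simp only [he, add_assoc r 1, ← succ_nsmul']
  exact key (fun i => c i r) (fun i => c i (r + 1)) (fun i => e (r + i • 1)) (b r) (congrFun hc r)

/-- A product of linear factors whose leading coefficients do not vanish alternates between
diagonal and circulant matrices. -/
theorem bandMatrix_linearProdCoeff_mem {n : ℕ} [NeZero n] (j : ℕ) (p : ℕ → Fin n → ℂ)
    (h : ∀ r, linearProdCoeff p j j r ≠ 0) :
    bandMatrix (j + 1) (linearProdCoeff p j) ∈
      diagonalMatrices n * (circulantMatrices n * diagonalMatrices n) ^ j := by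
  induction j with
  | zero =>
    rw [pow_zero, mul_one]
    simp [bandMatrix, diagonal_mem_diagonalMatrices]
  | succ j ih =>
    have hz : linearProdCoeff p j (j + 1) = 0 := linearProdCoeff_eq_zero p (Nat.lt_succ_self j)
    -- The top coefficient is a product of shifted values of all the `pᵢ`, so its nonvanishing
    -- passes to each factor.
    have h' : ∀ r, p (j + 1) r ≠ 0 ∧ linearProdCoeff p j j (r + 1) ≠ 0 := by
      intro r
      have := h r
      simp only [linearProdCoeff, mulLinearCoeff, hz, Pi.zero_apply, zero_add] at this
      exact mul_ne_zero_iff.1 this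
    have hj : ∀ r, linearProdCoeff p j j r ≠ 0 := fun r => by
      have := (h' (r - 1)).2
      rwa [sub_add_cancel] at this
    rw [linearProdCoeff, bandMatrix_mulLinearCoeff _ _ _ hz]
    have := Set.mul_mem_mul (one_add_diagonal_mul_cyclicShift_mem fun r => (h' r).1) (ih hj)
    rwa [mul_assoc, mul_assoc, ← mul_assoc (diagonalMatrices n) (diagonalMatrices n),
      diagonalMatrices_mul_self, ← mul_assoc (circulantMatrices n), ← pow_succ'] at this

/-! ### Polynomial functions and generic choices -/

/-- The polynomial functions on the affine space `ι → ℂ`. -/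
noncomputable def mvPolynomialFunctions (ι : Type*) : Subalgebra ℂ ((ι → ℂ) → ℂ) :=
  (MvPolynomial.aeval fun i (y : ι → ℂ) => y i).range

theorem aeval_coord_apply {ι : Type*} (p : MvPolynomial ι ℂ) (y : ι → ℂ) :
    MvPolynomial.aeval (fun i (y : ι → ℂ) => y i) p y = MvPolynomial.eval y p := by
  induction p using MvPolynomial.induction_on with
  | C a => simp
  | add p q hp hq => simp [hp, hq]
  | mul_X p i hp => simp [hp]

theorem mem_mvPolynomialFunctions_iff {ι : Type*} {f : (ι → ℂ) → ℂ} :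
    f ∈ mvPolynomialFunctions ι ↔ ∃ p : MvPolynomial ι ℂ, ∀ y, MvPolynomial.eval y p = f y := by
  constructor
  · rintro ⟨p, rfl⟩
    exact ⟨p, fun y => (aeval_coord_apply p y).symm⟩
  · rintro ⟨p, hp⟩
    exact ⟨p, funext fun y => (aeval_coord_apply p y).trans (hp y)⟩

theorem coord_mem_mvPolynomialFunctions {ι : Type*} (i : ι) :
    (fun y : ι → ℂ => y i) ∈ mvPolynomialFunctions ι :=
  mem_mvPolynomialFunctions_iff.2 ⟨MvPolynomial.X i, fun y => by simp⟩

theorem const_mem_mvPolynomialFunctions {ι : Type*} (a : ℂ) :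
    (fun _ : ι → ℂ => a) ∈ mvPolynomialFunctions ι :=
  mem_mvPolynomialFunctions_iff.2 ⟨MvPolynomial.C a, fun y => by simp⟩

theorem sum_mem_mvPolynomialFunctions {ι α : Type*} {s : Finset α} {f : α → (ι → ℂ) → ℂ}
    (hf : ∀ a ∈ s, f a ∈ mvPolynomialFunctions ι) :
    (fun y => ∑ a ∈ s, f a y) ∈ mvPolynomialFunctions ι := by
  convert Subalgebra.sum_mem _ hf using 1
  ext y
  simp

theorem mul_mem_mvPolynomialFunctions {ι : Type*} {f g : (ι → ℂ) → ℂ}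
    (hf : f ∈ mvPolynomialFunctions ι) (hg : g ∈ mvPolynomialFunctions ι) :
    (fun y => f y * g y) ∈ mvPolynomialFunctions ι := Subalgebra.mul_mem _ hf hg

theorem det_mem_mvPolynomialFunctions {ι m : Type*} [Fintype m] [DecidableEq m]
    {M : (ι → ℂ) → Matrix m m ℂ} (hM : ∀ i j, (fun y => M y i j) ∈ mvPolynomialFunctions ι) :
    (fun y => (M y).det) ∈ mvPolynomialFunctions ι := by
  simp only [Matrix.det_apply']
  refine sum_mem_mvPolynomialFunctions fun σ _ => ?_
  refine mul_mem_mvPolynomialFunctions (const_mem_mvPolynomialFunctions _) ?_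
  convert Subalgebra.prod_mem _ (t := Finset.univ) fun i _ => hM (σ i) i using 1
  ext y
  simp

theorem eval_comp_mem_mvPolynomialFunctions {ι κ : Type*} (u : MvPolynomial κ ℂ)
    {f : κ → (ι → ℂ) → ℂ} (hf : ∀ i, f i ∈ mvPolynomialFunctions ι) :
    (fun y => MvPolynomial.eval (fun i => f i y) u) ∈ mvPolynomialFunctions ι := by
  induction u using MvPolynomial.induction_on with
  | C a => simpa using const_mem_mvPolynomialFunctions a
  | add p q hp hq =>
    simp only [map_add]
    exact Subalgebra.add_mem _ hp hq
  | mul_X p i hp => simpa using mul_mem_mvPolynomialFunctions hp (hf i)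

/-- Finitely many nonzero polynomial functions have a common point where none vanishes. -/
theorem exists_forall_ne_zero_of_mem_mvPolynomialFunctions {ι α : Type*} [Finite α]
    {f : α → (ι → ℂ) → ℂ} (hf : ∀ a, f a ∈ mvPolynomialFunctions ι) (h : ∀ a, ∃ y, f a y ≠ 0) :
    ∃ y, ∀ a, f a y ≠ 0 := by
  have := Fintype.ofFinite α
  choose p hp using fun a => mem_mvPolynomialFunctions_iff.1 (hf a)
  have hp0 : ∀ a, p a ≠ 0 := by
    rintro a h0
    obtain ⟨y, hy⟩ := h a
    rw [← hp, h0, map_zero] at hy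
    exact hy rfl
  have hprod : ∏ a, p a ≠ 0 := Finset.prod_ne_zero_iff.2 fun a _ => hp0 a
  obtain ⟨y, hy⟩ : ∃ y, MvPolynomial.eval y (∏ a, p a) ≠ 0 := by
    by_contra! hcon
    exact hprod (MvPolynomial.funext fun y => by rw [hcon, map_zero])
  rw [map_prod, Finset.prod_ne_zero_iff] at hy
  exact ⟨y, fun a => by rw [← hp]; exact hy a (Finset.mem_univ a)⟩

/-! ### Cyclic windows and factorization of rank `k` matrices -/

/-- The `k × k` matrix formed by the cyclically consecutive rows `r, r + 1, …, r + k - 1`. -/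
def cyclicWindow {n k : ℕ} [NeZero n] (U : Matrix (Fin n) (Fin k) ℂ) (r : Fin n) :
    Matrix (Fin k) (Fin k) ℂ :=
  Matrix.of fun i l => U (r + (i : ℕ) • 1) l

theorem bandMatrix_mul_eq_vecMul_cyclicWindow {n k : ℕ} [NeZero n] (c : ℕ → Fin n → ℂ)
    (U : Matrix (Fin n) (Fin k) ℂ) (r : Fin n) :
    (bandMatrix k c * U) r = Matrix.vecMul (fun i : Fin k => c i r) (cyclicWindow U r) := by
  funext l
  rw [bandMatrix_mul_apply, Finset.sum_range]
  rfl

/-- The characters of the cyclic group span all functions on it, and a left inverse makes `v ↦ v U`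
surjective. -/
theorem span_range_sum_smul_addChar {n k : ℕ} [NeZero n] {L : Matrix (Fin k) (Fin n) ℂ}
    {U : Matrix (Fin n) (Fin k) ℂ} (hU : L * U = 1) :
    Submodule.span ℂ (Set.range fun χ : AddChar (Fin n) ℂ => ∑ s, χ s • U.row s) = ⊤ := by
  have hchar : Submodule.span ℂ
      (Set.range ((⇑) : AddChar (Fin n) ℂ → Fin n → ℂ)) = ⊤ :=
    (AddChar.linearIndependent (Fin n) ℂ).span_eq_top_of_card_eq_finrank' (by simp)
  let T : (Fin n → ℂ) →ₗ[ℂ] (Fin k → ℂ) := U.vecMulLinear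
  have hT : Function.Surjective T := fun v =>
    ⟨Matrix.vecMul v L, by simp [T, Matrix.vecMul_vecMul, hU]⟩
  have : (Set.range fun χ : AddChar (Fin n) ℂ => ∑ s, χ s • U.row s) =
      T '' Set.range ((⇑) : AddChar (Fin n) ℂ → Fin n → ℂ) := by
    rw [← Set.range_comp]
    congr 1
    funext χ l
    simp [T, Matrix.vecMul, dotProduct, Matrix.row]
  rw [this, Submodule.span_image, hchar, Submodule.map_top, LinearMap.range_eq_top.2 hT]

/-- For a matrix of full column rank, some circulant makes a given cyclic window invertible. -/
theorem exists_det_cyclicWindow_circulant_mul_ne_zero {n k : ℕ} [NeZero n]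
    {L : Matrix (Fin k) (Fin n) ℂ} {U : Matrix (Fin n) (Fin k) ℂ} (hU : L * U = 1) (r : Fin n) :
    ∃ c : Fin n → ℂ, (cyclicWindow (Matrix.circulant c * U) r).det ≠ 0 := by
  let u : AddChar (Fin n) ℂ → Fin k → ℂ := fun χ => ∑ s, χ s • U.row s
  have hspan := span_range_sum_smul_addChar hU
  obtain ⟨g, hg, -, hind⟩ := Submodule.exists_fun_fin_finrank_span_eq ℂ (Set.range u)
  have hk : Module.finrank ℂ (Submodule.span ℂ (Set.range u)) = k := by
    simp only [u]
    rw [hspan]; simp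
  choose χ hχ using hg
  have hg' : ∃ χ : Fin k → AddChar (Fin n) ℂ, LinearIndependent ℂ fun i => u (χ i) := by
    refine ⟨fun i => χ (Fin.cast hk.symm i), ?_⟩
    simp only [hχ]
    exact hind.comp _ (Fin.cast_injective _)
  clear hχ χ hind g
  obtain ⟨χ, hχ⟩ := hg'
  -- A character is determined by its value at the generator `-1`, so the Vandermonde nodes below
  -- are distinct.
  have hinj : Function.Injective fun i => χ i (-1) := by
    intro i j hij
    have h1 : ∀ s : Fin n, χ i s = χ j s := by
      intro s
      have hs : s = ((-s : Fin n) : ℕ) • (-1 : Fin n) := by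
        rw [smul_neg, Fin.val_nsmul_one_self, neg_neg]
      rw [hs, AddChar.map_nsmul_eq_pow, AddChar.map_nsmul_eq_pow]
      exact congrArg (· ^ _) hij
    have h2 : χ i = χ j := DFunLike.ext _ _ h1
    exact hχ.injective (congrArg u h2)
  refine ⟨fun t => ∑ l, χ l (r - t), ?_⟩
  have hfac : cyclicWindow (Matrix.circulant (fun t => ∑ l, χ l (r - t)) * U) r =
      (Matrix.vandermonde fun l => χ l (-1)).transpose * Matrix.of fun l => u (χ l) := by
    ext i m
    simp only [cyclicWindow, Matrix.of_apply, Matrix.mul_apply, Matrix.circulant_apply,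
      Matrix.transpose_apply, Matrix.vandermonde_apply, u, Finset.sum_apply, Pi.smul_apply,
      smul_eq_mul, Matrix.row, Finset.sum_mul, Finset.mul_sum]
    rw [Finset.sum_comm]
    refine Finset.sum_congr rfl fun l _ => Finset.sum_congr rfl fun s _ => ?_
    rw [← mul_assoc, ← AddChar.map_nsmul_eq_pow, ← AddChar.map_add_eq_mul]
    congr 2
    rw [smul_neg]
    abel
  rw [hfac, Matrix.det_mul, Matrix.det_transpose]
  refine mul_ne_zero (Matrix.det_vandermonde_ne_zero_iff.2 hinj) ?_
  rw [← isUnit_iff_ne_zero, ← Matrix.isUnit_iff_isUnit_det,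
    ← Matrix.linearIndependent_rows_iff_isUnit]
  exact hχ

/-- For a matrix of full column rank, some invertible circulant makes all cyclic windows
invertible. -/
theorem exists_circulant_forall_det_cyclicWindow_ne_zero {n k : ℕ} [NeZero n]
    {L : Matrix (Fin k) (Fin n) ℂ} {U : Matrix (Fin n) (Fin k) ℂ} (hU : L * U = 1) :
    ∃ C ∈ circulantMatrices n, IsUnit C ∧ ∀ r, (cyclicWindow (C * U) r).det ≠ 0 := by
  have hcirc : ∀ i j : Fin n, (fun c : Fin n → ℂ => Matrix.circulant c i j) ∈
      mvPolynomialFunctions (Fin n) := fun i j => coord_mem_mvPolynomialFunctions _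
  -- `none` encodes invertibility of the circulant, `some r` that of window `r`.
  obtain ⟨c, hc⟩ := exists_forall_ne_zero_of_mem_mvPolynomialFunctions (ι := Fin n)
    (α := Option (Fin n))
    (f := fun a c => a.elim (Matrix.circulant c).det
      fun r => (cyclicWindow (Matrix.circulant c * U) r).det) (by
        rintro (_ | r)
        · exact det_mem_mvPolynomialFunctions hcirc
        · refine det_mem_mvPolynomialFunctions fun i j => ?_
          simp only [cyclicWindow, Matrix.of_apply, Matrix.mul_apply]
          exact sum_mem_mvPolynomialFunctions fun s _ => mul_mem_mvPolynomialFunctions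
            (hcirc _ _) (const_mem_mvPolynomialFunctions _)) (by
        rintro (_ | r)
        · obtain ⟨c, hc⟩ := one_mem_circulantMatrices n
          exact ⟨c, by simp [← hc]⟩
        · exact exists_det_cyclicWindow_circulant_mul_ne_zero hU r)
  refine ⟨Matrix.circulant c, ⟨c, rfl⟩, ?_, fun r => hc (some r)⟩
  rw [Matrix.isUnit_iff_isUnit_det, isUnit_iff_ne_zero]
  exact hc none

/-- The extension by zero of a family of band coefficients. -/
def extendCoeff {n k : ℕ} (y : Fin k × Fin n → ℂ) : ℕ → Fin n → ℂ :=
  fun i r => if h : i < k then y (⟨i, h⟩, r) else 0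

theorem extendCoeff_val {n k : ℕ} (y : Fin k × Fin n → ℂ) (i : Fin k) (r : Fin n) :
    extendCoeff y i r = y (i, r) := dif_pos i.isLt

/-- Two matrices with invertible cyclic windows are related by almost any product of linear
factors on each side. -/
theorem exists_mul_eq_mul_of_det_cyclicWindow_ne_zero {n j : ℕ} [NeZero n]
    {U V : Matrix (Fin n) (Fin (j + 1)) ℂ} (hU : ∀ r, (cyclicWindow U r).det ≠ 0)
    (hV : ∀ r, (cyclicWindow V r).det ≠ 0) :
    ∃ A ∈ diagonalMatrices n * (circulantMatrices n * diagonalMatrices n) ^ j,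
      ∃ B ∈ diagonalMatrices n * (circulantMatrices n * diagonalMatrices n) ^ j,
        IsUnit A ∧ A * U = B * V := by
  obtain ⟨u, hu, hmem⟩ := exists_ne_zero_forall_exists_linearProdCoeff_eq n j
  have hfac : ∀ y : Fin (j + 1) × Fin n → ℂ, MvPolynomial.eval y u ≠ 0 →
      (∀ r, y (Fin.last j, r) ≠ 0) → bandMatrix (j + 1) (extendCoeff y) ∈
        diagonalMatrices n * (circulantMatrices n * diagonalMatrices n) ^ j := by
    intro y hy hlast
    obtain ⟨p, hp⟩ := hmem y hy
    have : bandMatrix (j + 1) (extendCoeff y) = bandMatrix (j + 1) (linearProdCoeff p j) := by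
      refine Finset.sum_congr rfl fun i hi => ?_
      congr 2
      funext r
      have hi := Finset.mem_range.1 hi
      rw [extendCoeff, dif_pos hi, ← hp]
    rw [this]
    exact bandMatrix_linearProdCoeff_mem j p fun r => by
      rw [show linearProdCoeff p j j r = y (Fin.last j, r) from hp (Fin.last j, r)]
      exact hlast r
  let M : Fin n → Matrix (Fin (j + 1)) (Fin (j + 1)) ℂ := fun r =>
    cyclicWindow U r * (cyclicWindow V r)⁻¹
  have hM : ∀ r, IsUnit (M r).det := fun r => by
    simp only [M, Matrix.det_mul, Matrix.det_nonsing_inv]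
    simpa [isUnit_iff_ne_zero] using ⟨hU r, hV r⟩
  -- Solves `A U = B V` row by row: `Φ` sends the coefficients of `A` to those of `B`.
  let Φ : (Fin (j + 1) × Fin n → ℂ) → Fin (j + 1) × Fin n → ℂ := fun y x =>
    Matrix.vecMul (fun i => y (i, x.2)) (M x.2) x.1
  have hΦpoly : ∀ x, (fun y => Φ y x) ∈ mvPolynomialFunctions (Fin (j + 1) × Fin n) := fun x => by
    simp only [Φ, Matrix.vecMul, dotProduct]
    exact sum_mem_mvPolynomialFunctions fun i _ => mul_mem_mvPolynomialFunctions
      (coord_mem_mvPolynomialFunctions _) (const_mem_mvPolynomialFunctions _)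
  have hΦ : ∀ z, ∃ y, Φ y = z := by
    intro z
    refine ⟨fun x => Matrix.vecMul (fun i => z (i, x.2)) (M x.2)⁻¹ x.1, ?_⟩
    funext x
    change Matrix.vecMul (Matrix.vecMul (fun i => z (i, x.2)) (M x.2)⁻¹) (M x.2) x.1 = z x
    rw [Matrix.vecMul_vecMul, Matrix.nonsing_inv_mul _ (hM _), Matrix.vecMul_one]
  have hu' : ∃ z, MvPolynomial.eval z u ≠ 0 := by
    by_contra! hcon
    exact hu (MvPolynomial.funext fun y => by rw [hcon, map_zero])
  have hband : ∀ y, bandMatrix (j + 1) (extendCoeff y) * U =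
      bandMatrix (j + 1) (extendCoeff (Φ y)) * V := by
    intro y
    funext r
    rw [bandMatrix_mul_eq_vecMul_cyclicWindow, bandMatrix_mul_eq_vecMul_cyclicWindow]
    have h1 : (fun i : Fin (j + 1) => extendCoeff (Φ y) i r) =
        Matrix.vecMul (fun i : Fin (j + 1) => extendCoeff y i r) (M r) := by
      simp only [extendCoeff_val, Φ]
    rw [h1, Matrix.vecMul_vecMul, mul_assoc,
      Matrix.nonsing_inv_mul _ (isUnit_iff_ne_zero.2 (hV r)), mul_one]
  -- Generic `y`: `A` and `B` both factor, `A` is invertible, and the top coefficients of both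
  -- vanish nowhere.
  obtain ⟨y, hy⟩ := exists_forall_ne_zero_of_mem_mvPolynomialFunctions
    (ι := Fin (j + 1) × Fin n) (α := (Unit ⊕ Unit ⊕ Unit) ⊕ (Fin n ⊕ Fin n))
    (f := Sum.elim (Sum.elim (fun _ y => MvPolynomial.eval y u)
        (Sum.elim (fun _ y => MvPolynomial.eval (Φ y) u)
          (fun _ y => (bandMatrix (j + 1) (extendCoeff y)).det)))
      (Sum.elim (fun r y => y (Fin.last j, r)) (fun r y => Φ y (Fin.last j, r)))) (by
        rintro ((_ | _ | _) | (r | r))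
        · exact mem_mvPolynomialFunctions_iff.2 ⟨u, fun y => rfl⟩
        · exact eval_comp_mem_mvPolynomialFunctions u hΦpoly
        · refine det_mem_mvPolynomialFunctions fun s t => ?_
          simp only [bandMatrix, Matrix.sum_apply, Matrix.diagonal_mul]
          refine sum_mem_mvPolynomialFunctions fun i hi => mul_mem_mvPolynomialFunctions ?_
            (const_mem_mvPolynomialFunctions _)
          simp only [extendCoeff, dif_pos (Finset.mem_range.1 hi)]
          exact coord_mem_mvPolynomialFunctions _
        · exact coord_mem_mvPolynomialFunctions _
        · exact hΦpoly _) (by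
        rintro ((_ | _ | _) | (r | r))
        · exact hu'
        · obtain ⟨z, hz⟩ := hu'
          obtain ⟨y, rfl⟩ := hΦ z
          exact ⟨y, hz⟩
        · refine ⟨fun x => if x.1 = 0 then 1 else 0, ?_⟩
          have : bandMatrix (j + 1)
              (extendCoeff fun x : Fin (j + 1) × Fin n => if x.1 = 0 then 1 else 0) = 1 := by
            rw [bandMatrix, Finset.sum_eq_single 0]
            · ext s t
              simp [extendCoeff, Matrix.one_apply]
            · intro i hi hi0
              have hi := Finset.mem_range.1 hi
              have : extendCoeff
                  (fun x : Fin (j + 1) × Fin n => if x.1 = 0 then 1 else 0) i = 0 := by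
                funext r
                simp [extendCoeff, hi0]
              rw [this]
              simp
            · simp
          simp [this]
        · exact ⟨fun _ => 1, by simp⟩
        · obtain ⟨y, hy⟩ := hΦ fun _ => 1
          exact ⟨y, by simp [hy]⟩)
  refine ⟨_, hfac y (hy (.inl (.inl ()))) fun r => hy (.inr (.inl r)), _,
    hfac (Φ y) (hy (.inl (.inr (.inl ())))) fun r => hy (.inr (.inr r)), ?_, hband y⟩
  rw [Matrix.isUnit_iff_isUnit_det, isUnit_iff_ne_zero]
  exact hy (.inl (.inr (.inr ())))

/-- A matrix of full column rank `k` is formed by the first `k` columns of an alternating product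
of circulant and diagonal matrices. -/
theorem exists_mem_mul_castLE_eq {n k : ℕ} (hk : 0 < k) (hkn : k ≤ n)
    {L : Matrix (Fin k) (Fin n) ℂ} {U : Matrix (Fin n) (Fin k) ℂ} (hU : L * U = 1) :
    ∃ F ∈ (circulantMatrices n * diagonalMatrices n) ^ (2 * k - 1) * circulantMatrices n,
      F * (1 : Matrix (Fin n) (Fin n) ℂ).submatrix id (Fin.castLE hkn) = U := by
  obtain ⟨j, rfl⟩ : ∃ j, k = j + 1 := ⟨k - 1, by omega⟩
  have : NeZero n := ⟨by omega⟩
  set E := (1 : Matrix (Fin n) (Fin n) ℂ).submatrix id (Fin.castLE hkn)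
  have hEE : E.transpose * E = 1 := by
    ext a b
    simp [E, Matrix.mul_apply, Matrix.one_apply]
  obtain ⟨C₀, hC₀, hC₀u, hW₀⟩ := exists_circulant_forall_det_cyclicWindow_ne_zero hU
  obtain ⟨C₁, hC₁, -, hW₁⟩ := exists_circulant_forall_det_cyclicWindow_ne_zero hEE
  obtain ⟨A, hA, B, hB, hAu, hAB⟩ := exists_mul_eq_mul_of_det_cyclicWindow_ne_zero hW₀ hW₁
  refine ⟨C₀⁻¹ * ((A⁻¹ * B) * C₁), ?_, ?_⟩
  · have h1 : A⁻¹ * B ∈ diagonalMatrices n *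
        (circulantMatrices n * diagonalMatrices n) ^ (2 * j) := by
      have hA' := inv_mem_diagonal_mul_pow hA hAu
      rw [← mul_pow_mul] at hA'
      have := Set.mul_mem_mul hA' hB
      rwa [mul_assoc, ← mul_assoc (diagonalMatrices n) (diagonalMatrices n),
        diagonalMatrices_mul_self, ← mul_assoc, mul_pow_mul, mul_assoc, ← pow_add,
        ← two_mul] at this
    have := Set.mul_mem_mul (inv_mem_circulantMatrices hC₀ hC₀u) (Set.mul_mem_mul h1 hC₁)
    rwa [← mul_assoc, ← mul_assoc, ← pow_succ',
      show 2 * j + 1 = 2 * (j + 1) - 1 by omega] at this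
  · have h1 := (Matrix.isUnit_iff_isUnit_det _).1 hAu
    have h2 := (Matrix.isUnit_iff_isUnit_det _).1 hC₀u
    rw [Matrix.mul_assoc, Matrix.mul_assoc, Matrix.mul_assoc, ← hAB,
      Matrix.nonsing_inv_mul_cancel_left _ _ h1, Matrix.nonsing_inv_mul_cancel_left _ _ h2]

/-- A matrix with a rank `k` singular value type factorization is a product of `4 * k + 1`
products of a diagonal and a circulant matrix. -/
theorem mul_diagonal_mul_transpose_mem_pow {n k : ℕ} (hk : 0 < k) (hkn : k ≤ n)
    {L L' : Matrix (Fin k) (Fin n) ℂ} {U V : Matrix (Fin n) (Fin k) ℂ} (hU : L * U = 1)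
    (hV : L' * V = 1) (s : Fin k → ℂ) :
    U * Matrix.diagonal s * V.transpose ∈
      (diagonalMatrices n * circulantMatrices n) ^ (4 * k + 1) := by
  obtain ⟨F, hF, rfl⟩ := exists_mem_mul_castLE_eq hk hkn hU
  obtain ⟨G, hG, rfl⟩ := exists_mem_mul_castLE_eq hk hkn hV
  set E := (1 : Matrix (Fin n) (Fin n) ℂ).submatrix id (Fin.castLE hkn)
  have hP : E * Matrix.diagonal s * E.transpose ∈ diagonalMatrices n := by
    intro a b hab
    rw [Matrix.mul_apply]
    simp only [E, Matrix.mul_diagonal, Matrix.transpose_apply,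
      Matrix.submatrix_apply, id, Matrix.one_apply]
    refine Finset.sum_eq_zero fun l _ => ?_
    by_cases h1 : a = Fin.castLE hkn l
    · simp [show b ≠ Fin.castLE hkn l from fun h2 => hab (h1.trans h2.symm)]
    · simp [h1]
  have hG' : G.transpose ∈
      circulantMatrices n * (diagonalMatrices n * circulantMatrices n) ^ (2 * k - 1) := by
    obtain ⟨X, hX, Y, hY, rfl⟩ := hG
    simp only [Matrix.transpose_mul]
    exact Set.mul_mem_mul (transpose_mem_circulantMatrices hY)
      (transpose_mem_pow (fun _ => transpose_mem_circulantMatrices)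
        (fun _ => transpose_mem_diagonalMatrices) hX)
  have hmem := Set.mul_mem_mul hF (Set.mul_mem_mul hP hG')
  have h1 : F * (E * Matrix.diagonal s * E.transpose * G.transpose) =
      F * E * Matrix.diagonal s * (G * E).transpose := by
    simp only [Matrix.transpose_mul, Matrix.mul_assoc]
  have h2 : (circulantMatrices n * diagonalMatrices n) ^ (2 * k - 1) * circulantMatrices n *
      (diagonalMatrices n * (circulantMatrices n *
        (diagonalMatrices n * circulantMatrices n) ^ (2 * k - 1))) =
      circulantMatrices n * (diagonalMatrices n * circulantMatrices n) ^ (4 * k - 1) := by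
    rw [mul_pow_mul, mul_assoc, ← mul_assoc (diagonalMatrices n), ← pow_succ', ← pow_add]
    congr 2
    omega
  rw [h1, h2] at hmem
  -- The product has `4k` circulants and `4k - 1` diagonals; a leading identity completes `4k`
  -- factors `D C`, and one further trivial factor pads to `4k + 1`.
  have h3 := Set.mul_mem_mul (one_mem_diagonalMatrices n) hmem
  have h4 := Set.mul_mem_mul (Set.mul_mem_mul (one_mem_diagonalMatrices n)
    (one_mem_circulantMatrices n)) h3
  rw [← mul_assoc (diagonalMatrices n) (circulantMatrices n), ← pow_succ', ← pow_succ'] at h4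
  simpa only [one_mul, show 4 * k - 1 + 1 + 1 = 4 * k + 1 by omega] using h4

end

/-! ### Truncated singular value decomposition -/

section

open scoped InnerProductSpace

theorem Fin.sum_castLE_eq_sum_ite {M : Type*} [AddCommMonoid M] {k n : ℕ} (h : k ≤ n)
    (f : Fin n → M) : ∑ l : Fin k, f (Fin.castLE h l) = ∑ i : Fin n, if (i : ℕ) < k then f i else 0 := by
  obtain ⟨m, rfl⟩ := Nat.exists_eq_add_of_le h
  rw [Fin.sum_univ_add]
  have h2 : ∀ i : Fin m, (if ((Fin.natAdd k i : Fin (k + m)) : ℕ) < k then f (Fin.natAdd k i)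
      else 0) = 0 := fun i => if_neg (by simp)
  simp only [h2, Finset.sum_const_zero, add_zero]
  refine Finset.sum_congr rfl fun l _ => ?_
  rw [if_pos (by simp)]
  rfl

/-- Singular value decomposition of an endomorphism of a finite dimensional space. -/
theorem LinearMap.exists_orthonormalBasis_apply_eq_singularValues_smul {E : Type*}
    [NormedAddCommGroup E] [InnerProductSpace ℂ E] [FiniteDimensional ℂ E] {n : ℕ}
    (hn : Module.finrank ℂ E = n) (T : E →ₗ[ℂ] E) :
    ∃ v b : OrthonormalBasis (Fin n) ℂ E, ∀ i, T (v i) = (T.singularValues i : ℂ) • b i := by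
  let hs := T.isSymmetric_adjoint_comp_self
  let v := hs.eigenvectorBasis hn
  have hinner : ∀ i j, ⟪T (v i), T (v j)⟫_ℂ =
      ((T.singularValues j : ℂ) ^ 2) * if i = j then 1 else 0 := by
    intro i j
    have h1 : (T.adjoint ∘ₗ T) (v j) = ((hs.eigenvalues hn j : ℝ) : ℂ) • v j :=
      hs.apply_eigenvectorBasis hn j
    rw [← LinearMap.adjoint_inner_right, ← LinearMap.comp_apply, h1, inner_smul_right,
      ← T.sq_singularValues_fin hn, orthonormal_iff_ite.1 v.orthonormal]
    push_cast
    rfl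
  -- The vectors `T (v i)` are orthogonal of norm `σᵢ`; the nonzero ones, normalized, extend to the
  -- second basis.
  let w : Fin n → E := fun i => (T.singularValues i : ℂ)⁻¹ • T (v i)
  have hw : Orthonormal ℂ (Set.domRestrict {i : Fin n | T.singularValues i ≠ 0} w) := by
    rw [orthonormal_iff_ite]
    rintro ⟨i, hi⟩ ⟨j, hj⟩
    have hj : T.singularValues j ≠ 0 := hj
    simp only [Set.domRestrict_apply, w, inner_smul_left, inner_smul_right, hinner, Subtype.mk.injEq]
    split_ifs with h
    · subst h
      have : (T.singularValues i : ℂ) ≠ 0 := by exact_mod_cast hj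
      simp only [map_inv₀, Complex.conj_ofReal]
      field_simp
    · simp
  obtain ⟨b, hb⟩ := hw.exists_orthonormalBasis_extension_of_card_eq (by simpa using hn)
  refine ⟨v, b, fun i => ?_⟩
  by_cases hi : T.singularValues i = 0
  · have := hinner i i
    rw [hi] at this
    simpa [hi] using this
  · have : (T.singularValues i : ℂ) ≠ 0 := by exact_mod_cast hi
    rw [hb i hi, smul_inv_smul₀ this]

/-- Parseval in both bases. -/
theorem OrthonormalBasis.norm_sum_smul_inner_le {E : Type*} [NormedAddCommGroup E]
    [InnerProductSpace ℂ E] {ι : Type*} [Fintype ι] (v b : OrthonormalBasis ι ℂ E) {τ : ι → ℝ}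
    {t : ℝ} (h0 : ∀ i, 0 ≤ τ i) (ht : ∀ i, τ i ≤ t) (ht0 : 0 ≤ t) (x : E) :
    ‖∑ i, ((τ i : ℂ) * ⟪v i, x⟫_ℂ) • b i‖ ≤ t * ‖x‖ := by
  refine le_of_sq_le_sq ?_ (by positivity)
  rw [← b.sum_sq_norm_inner_right, mul_pow, ← v.sum_sq_norm_inner_right x, Finset.mul_sum]
  refine Finset.sum_le_sum fun i _ => ?_
  rw [b.orthonormal.inner_right_fintype, norm_mul, mul_pow, Complex.norm_real, Real.norm_eq_abs,
    abs_of_nonneg (h0 i)]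
  gcongr
  · exact h0 i
  · exact ht i

/-- The truncated singular value decomposition of a matrix. -/
theorem Matrix.exists_truncated_svd {n k : ℕ} (hk : 0 < k) (hkn : k ≤ n)
    (W : Matrix (Fin n) (Fin n) ℂ) :
    ∃ (U V : Matrix (Fin n) (Fin k) ℂ) (s : Fin k → ℂ), U.conjTranspose * U = 1 ∧
      V.conjTranspose * V = 1 ∧
      (∀ x, ‖Matrix.toEuclideanLin W x - Matrix.toEuclideanLin (U * diagonal s * V.transpose) x‖ ≤
        (Matrix.toEuclideanLin W).singularValues (k - 1) * ‖x‖) ∧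
      ∀ x, ‖Matrix.toEuclideanLin (U * diagonal s * V.transpose) x‖ ≤
        (Matrix.toEuclideanLin W).singularValues 0 * ‖x‖ := by
  set T := Matrix.toEuclideanLin W with hT
  obtain ⟨v, b, hvb⟩ := T.exists_orthonormalBasis_apply_eq_singularValues_smul
    (finrank_euclideanSpace_fin (𝕜 := ℂ) (n := n))
  let U : Matrix (Fin n) (Fin k) ℂ := Matrix.of fun r l => b (Fin.castLE hkn l) r
  -- Conjugated, so that the plain transpose of `V` computes the inner products with the `v i`.
  let V : Matrix (Fin n) (Fin k) ℂ := Matrix.of fun r l => star (v (Fin.castLE hkn l) r)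
  let s : Fin k → ℂ := fun l => T.singularValues l
  have hTx : ∀ x, T x = ∑ i : Fin n, ((T.singularValues i : ℂ) * ⟪v i, x⟫_ℂ) • b i := by
    intro x
    conv_lhs => rw [← v.sum_repr' x, map_sum]
    refine Finset.sum_congr rfl fun i _ => ?_
    rw [map_smul, hvb, smul_smul, mul_comm]
  have hMx : ∀ x, Matrix.toEuclideanLin (U * diagonal s * V.transpose) x =
      ∑ i : Fin n, (((if (i : ℕ) < k then T.singularValues i else 0 : ℝ) : ℂ) * ⟪v i, x⟫_ℂ) •
        b i := by
    intro x
    have h1 := Fin.sum_castLE_eq_sum_ite hkn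
      fun i : Fin n => ((T.singularValues i : ℂ) * ⟪v i, x⟫_ℂ) • b i
    have h2 : ∀ i : Fin n, (((if (i : ℕ) < k then T.singularValues i else 0 : ℝ) : ℂ) *
        ⟪v i, x⟫_ℂ) • b i = if (i : ℕ) < k then ((T.singularValues i : ℂ) * ⟪v i, x⟫_ℂ) • b i
        else 0 := fun i => by split_ifs <;> simp
    simp only [h2, ← h1]
    ext r
    have h3 : (Matrix.toEuclideanLin (U * diagonal s * V.transpose) x) r =
        ∑ l, U r l * (s l * (V.transpose.mulVec x.ofLp) l) := by
      rw [Matrix.toLpLin_apply]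
      simp only [← Matrix.mulVec_mulVec]
      rw [Matrix.mulVec, dotProduct]
      exact Finset.sum_congr rfl fun l _ => by rw [Matrix.mulVec_diagonal]
    rw [h3]
    simp only [WithLp.ofLp_sum, Finset.sum_apply]
    refine Finset.sum_congr rfl fun l _ => ?_
    simp only [Matrix.mulVec, dotProduct, U, V, s, Matrix.of_apply, Matrix.transpose_apply,
      PiLp.smul_apply, smul_eq_mul, PiLp.inner_apply, RCLike.inner_apply, Fin.val_castLE]
    rw [mul_comm]
    congr 2
    exact Finset.sum_congr rfl fun t _ => mul_comm _ _
  refine ⟨U, V, s, ?_, ?_, fun x => ?_, fun x => ?_⟩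
  · ext i j
    have := orthonormal_iff_ite.1 b.orthonormal (Fin.castLE hkn i) (Fin.castLE hkn j)
    simp only [PiLp.inner_apply, RCLike.inner_apply] at this
    simp only [Matrix.mul_apply, Matrix.conjTranspose_apply, U, Matrix.of_apply, Matrix.one_apply]
    simpa [mul_comm] using this
  · ext i j
    have := orthonormal_iff_ite.1 v.orthonormal (Fin.castLE hkn j) (Fin.castLE hkn i)
    simp only [PiLp.inner_apply, RCLike.inner_apply] at this
    simp only [Matrix.mul_apply, Matrix.conjTranspose_apply, V, Matrix.of_apply, Matrix.one_apply,
      star_star]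
    simpa [eq_comm] using this
  · rw [hTx, hMx, ← Finset.sum_sub_distrib]
    have : ∀ i : Fin n, ((T.singularValues i : ℂ) * ⟪v i, x⟫_ℂ) • b i -
        (((if (i : ℕ) < k then T.singularValues i else 0 : ℝ) : ℂ) * ⟪v i, x⟫_ℂ) • b i =
        (((if (i : ℕ) < k then 0 else T.singularValues i : ℝ) : ℂ) * ⟪v i, x⟫_ℂ) • b i := by
      intro i
      split_ifs <;> simp
    simp only [this]
    refine v.norm_sum_smul_inner_le b (fun i => ?_) (fun i => ?_) (T.singularValues_nonneg _) x
    · split_ifs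
      exacts [le_rfl, T.singularValues_nonneg _]
    · split_ifs with h
      · exact T.singularValues_nonneg _
      -- Indices are zero-based: the remainder has `i ≥ k`, while the bound is taken at `k - 1`, the
      -- `k`-th largest value.
      · exact T.singularValues_antitone (by omega)
  · rw [hMx]
    refine v.norm_sum_smul_inner_le b (fun i => ?_) (fun i => ?_) (T.singularValues_nonneg _) x
    · split_ifs
      exacts [T.singularValues_nonneg _, le_rfl]
    · split_ifs with h
      · exact T.singularValues_antitone (Nat.zero_le _)
      · exact T.singularValues_nonneg _

end

/-! ### ReLU layers, biases and error propagation -/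

section

open scoped Pointwise

theorem norm_complexReLU_sub_le (z w : ℂ) : ‖complexReLU z - complexReLU w‖ ≤ ‖z - w‖ := by
  refine le_of_sq_le_sq ?_ (norm_nonneg _)
  rw [Complex.sq_norm, Complex.sq_norm, Complex.normSq_apply, Complex.normSq_apply, ← sq, ← sq,
    ← sq, ← sq]
  have h : ∀ a b : ℝ, (max 0 a - max 0 b) ^ 2 ≤ (a - b) ^ 2 := fun a b =>
    sq_le_sq.2 (by simpa [max_comm] using abs_max_sub_max_le_abs a b 0)
  exact add_le_add (h z.re w.re) (h z.im w.im)

theorem complexReLU_of_nonneg {z : ℂ} (h1 : 0 ≤ z.re) (h2 : 0 ≤ z.im) : complexReLU z = z :=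
  Complex.ext (max_eq_right h1) (max_eq_right h2)

theorem norm_affineLayer_relu_sub_le {n : ℕ} (W W' : Matrix (Fin n) (Fin n) ℂ)
    (b b' x y : CVec n) :
    ‖affineLayer .relu W b x - affineLayer .relu W' b' y‖ ≤
      ‖(Matrix.toEuclideanLin W x + b) - (Matrix.toEuclideanLin W' y + b')‖ := by
  rw [EuclideanSpace.norm_eq, EuclideanSpace.norm_eq]
  refine Real.sqrt_le_sqrt (Finset.sum_le_sum fun i _ => ?_)
  gcongr
  exact norm_complexReLU_sub_le _ _

theorem isBounded_image_affineLayer {n : ℕ} (W : Matrix (Fin n) (Fin n) ℂ) (b : CVec n)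
    {Y : Set (CVec n)} (hY : Bornology.IsBounded Y) :
    Bornology.IsBounded (affineLayer .relu W b '' Y) := by
  let T := (Matrix.toEuclideanLin W).toContinuousLinearMap
  obtain ⟨K, hK⟩ := hY.exists_norm_le
  rw [isBounded_iff_forall_norm_le]
  refine ⟨‖T‖ * K + ‖b‖, ?_⟩
  rintro _ ⟨y, hy, rfl⟩
  have h0 : affineLayer .relu (0 : Matrix (Fin n) (Fin n) ℂ) 0 (0 : CVec n) = 0 := by
    ext i
    simp [affineLayer, Activation.apply, complexReLU_of_nonneg]
  have h1 := norm_affineLayer_relu_sub_le W 0 b 0 y 0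
  rw [h0] at h1
  simp only [sub_zero, map_zero, add_zero] at h1
  calc _ ≤ ‖T y + b‖ := h1
    _ ≤ ‖T y‖ + ‖b‖ := norm_add_le _ _
    _ ≤ ‖T‖ * K + ‖b‖ := by
        gcongr
        exact (T.le_opNorm y).trans (by gcongr; exact hK y hy)

/-- On a bounded set, a large enough bias turns the ReLU into the identity. -/
theorem exists_bias_affineLayer_relu_eq {n : ℕ} (W : Matrix (Fin n) (Fin n) ℂ)
    {Y : Set (CVec n)} (hY : Bornology.IsBounded Y) :
    ∃ β : CVec n, ∀ y ∈ Y, affineLayer .relu W β y = Matrix.toEuclideanLin W y + β := by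
  let T := (Matrix.toEuclideanLin W).toContinuousLinearMap
  obtain ⟨K, hK⟩ := hY.exists_norm_le
  let B : ℝ := ‖T‖ * K
  refine ⟨WithLp.toLp 2 fun _ => ⟨B, B⟩, fun y hy => ?_⟩
  ext i
  have h1 : ‖(T y) i‖ ≤ B := (PiLp.norm_apply_le _ i).trans
    ((T.le_opNorm y).trans (mul_le_mul_of_nonneg_left (hK y hy) (norm_nonneg _)))
  have h2 := (abs_le.1 ((Complex.abs_re_le_norm _).trans h1)).1
  have h3 := (abs_le.1 ((Complex.abs_im_le_norm _).trans h1)).1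
  refine complexReLU_of_nonneg ?_ ?_
  · change 0 ≤ ((T y) i).re + B
    linarith
  · change 0 ≤ ((T y) i).im + B
    linarith

theorem iterateLayers_castSucc {E : Type*} {m : ℕ} (f : Fin (m + 1) → E → E) (x : E)
    (i : Fin (m + 1)) :
    iterateLayers f x i.castSucc = iterateLayers (fun j => f j.castSucc) x i := by
  induction i using Fin.induction with
  | zero => rfl
  | succ i ih =>
    change f i.castSucc (iterateLayers f x i.castSucc.castSucc) = _
    rw [ih]
    rfl

theorem iterateLayers_last {E : Type*} {m : ℕ} (f : Fin (m + 1) → E → E) (x : E) :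
    iterateLayers f x (Fin.last (m + 1)) =
      f (Fin.last m) (iterateLayers (fun j => f j.castSucc) x (Fin.last m)) := by
  rw [← iterateLayers_castSucc]
  rfl

/-- A map that agrees on a set with a diagonal circulant ReLU network of the given depth. -/
def IsDCNNOn {n : ℕ} (m : ℕ) (g : CVec n → CVec n) (X : Set (CVec n)) : Prop :=
  ∃ N' : DCNN n m, (∀ i, N'.act i = Activation.relu) ∧ ∀ x ∈ X, N'.eval x = g x

theorem IsDCNNOn.congr {n m : ℕ} {g h : CVec n → CVec n} {X : Set (CVec n)} (hg : IsDCNNOn m g X)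
    (hgh : ∀ x ∈ X, g x = h x) : IsDCNNOn m h X := by
  obtain ⟨N', h1, h2⟩ := hg
  exact ⟨N', h1, fun x hx => (h2 x hx).trans (hgh x hx)⟩

theorem isDCNNOn_zero {n : ℕ} (X : Set (CVec n)) : IsDCNNOn 0 id X :=
  ⟨⟨fun i => i.elim0, fun i => i.elim0, fun i => i.elim0, fun i => i.elim0, fun i => i.elim0,
    fun i => i.elim0⟩, fun i => i.elim0, fun _ _ => rfl⟩

theorem IsDCNNOn.layer {n m : ℕ} {g : CVec n → CVec n} {X : Set (CVec n)} (hg : IsDCNNOn m g X)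
    {M : Matrix (Fin n) (Fin n) ℂ} (hM : M ∈ diagonalMatrices n * circulantMatrices n)
    (b : CVec n) : IsDCNNOn (m + 1) (fun x => affineLayer .relu M b (g x)) X := by
  obtain ⟨D, hD, C, hC, rfl⟩ := hM
  have hD' : D.IsDiag := hD
  have hC' : ∃ c : Fin n → ℂ, C = Matrix.circulant c := hC
  obtain ⟨N', h1, h2⟩ := hg
  refine ⟨⟨Fin.snoc (α := fun _ => Matrix (Fin n) (Fin n) ℂ) N'.D D,
    Fin.snoc (α := fun _ => Matrix (Fin n) (Fin n) ℂ) N'.C C,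
    Fin.snoc (α := fun _ => CVec n) N'.b b, fun _ => .relu, fun i => ?_, fun i => ?_⟩,
    fun _ => rfl, fun x hx => ?_⟩
  · induction i using Fin.lastCases with
    | last => simpa using hD'
    | cast i => simpa using N'.isDiag i
  · induction i using Fin.lastCases with
    | last => simpa using hC'
    | cast i => simpa using N'.isCirculant i
  · change _ = affineLayer .relu (D * C) b (g x)
    rw [← h2 x hx]
    simp only [DCNN.eval]
    rw [iterateLayers_last]
    simp [h1]

/-- Peels off the rightmost factor, which acts first, with a bias `β` making its ReLU inactive on
the bounded image. The shift `M' β` is subtracted from the later bias, so only the last ReLU really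
acts. -/
theorem IsDCNNOn.affineLayer {n j m : ℕ} {g : CVec n → CVec n} {X : Set (CVec n)}
    (hg : IsDCNNOn j g X) (hb : Bornology.IsBounded (g '' X)) {M : Matrix (Fin n) (Fin n) ℂ}
    (hM : M ∈ (diagonalMatrices n * circulantMatrices n) ^ (m + 1)) (b : CVec n) :
    IsDCNNOn (j + (m + 1)) (fun x => _root_.affineLayer .relu M b (g x)) X := by
  induction m generalizing j g M b with
  | zero =>
    rw [zero_add, pow_one] at hM
    exact hg.layer hM b
  | succ m ih =>
    rw [pow_succ] at hM
    obtain ⟨M', hM', T, hT, rfl⟩ := hM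
    obtain ⟨β, hβ⟩ := exists_bias_affineLayer_relu_eq T hb
    have hg' := hg.layer hT β
    have hb' : Bornology.IsBounded ((fun x => _root_.affineLayer .relu T β (g x)) '' X) := by
      have := isBounded_image_affineLayer T β hb
      rwa [← Set.image_comp] at this
    have := ih hg' hb' hM' (b - Matrix.toEuclideanLin M' β)
    rw [show j + 1 + (m + 1) = j + (m + 1 + 1) by omega] at this
    refine this.congr fun x hx => ?_
    rw [hβ _ (Set.mem_image_of_mem g hx)]
    have h : Matrix.toEuclideanLin M' (Matrix.toEuclideanLin T (g x) + β) +
        (b - Matrix.toEuclideanLin M' β) = Matrix.toEuclideanLin (M' * T) (g x) + b := by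
      rw [map_add, Matrix.toLpLin_mul_same, LinearMap.comp_apply]
      abel
    simp only [_root_.affineLayer, h]

/-- A ReLU network whose weights are products of diagonal and circulant matrices is, on bounded
sets, a diagonal circulant network. -/
theorem ReLUNetwork.isDCNNOn_eval {n L m : ℕ} (N : ReLUNetwork n L)
    (hN : ∀ i, N.W i ∈ (diagonalMatrices n * circulantMatrices n) ^ (m + 1)) {X : Set (CVec n)}
    (hX : Bornology.IsBounded X) : IsDCNNOn (L * (m + 1)) N.eval X := by
  suffices h : ∀ i : Fin (L + 1), IsDCNNOn (i * (m + 1)) (fun x => N.output x i) X ∧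
      Bornology.IsBounded ((fun x => N.output x i) '' X) from (h (Fin.last L)).1
  intro i
  induction i using Fin.induction with
  | zero =>
    refine ⟨?_, ?_⟩
    · rw [Fin.val_zero, zero_mul]
      exact isDCNNOn_zero X
    · change Bornology.IsBounded ((fun x => x) '' X)
      rwa [Set.image_id']
  | succ i ih =>
    obtain ⟨h1, h2⟩ := ih
    refine ⟨?_, ?_⟩
    · have := h1.affineLayer h2 (hN i) (N.b i)
      rwa [Fin.val_castSucc, ← Nat.succ_mul] at this
    · have := isBounded_image_affineLayer (N.W i) (N.b i) h2
      rwa [← Set.image_comp] at this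

theorem ReLUNetwork.sigma_nonneg {n L : ℕ} (N : ReLUNetwork n L) (i : Fin L) (j : ℕ) :
    0 ≤ N.sigma i j := LinearMap.singularValues_nonneg _ _

theorem ReLUNetwork.sigma_le_sigmaMax {n L : ℕ} (N : ReLUNetwork n L) (i : Fin L) (j : ℕ) :
    N.sigma i j ≤ N.sigmaMax j :=
  le_ciSup (f := fun i => N.sigma i j) (Set.finite_range _).bddAbove i

theorem ReLUNetwork.sigmaMax_nonneg {n L : ℕ} (N : ReLUNetwork n L) (j : ℕ) :
    0 ≤ N.sigmaMax j := Real.iSup_nonneg fun i => N.sigma_nonneg i j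

/-- Propagation of the error when the weights of a ReLU network are perturbed. -/
theorem ReLUNetwork.norm_eval_sub_eval_le {n L : ℕ} (N N' : ReLUNetwork n L) (hb : N'.b = N.b)
    {δ σ R : ℝ} (hδ : 0 ≤ δ) (hσ : 0 ≤ σ)
    (h1 : ∀ i x, ‖Matrix.toEuclideanLin (N.W i) x - Matrix.toEuclideanLin (N'.W i) x‖ ≤ δ * ‖x‖)
    (h2 : ∀ i x, ‖Matrix.toEuclideanLin (N'.W i) x‖ ≤ σ * ‖x‖) (x : CVec n)
    (hR : ∀ i, ‖N.output x i‖ ≤ R) :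
    ‖N.eval x - N'.eval x‖ ≤ δ * R * ∑ t ∈ Finset.range L, σ ^ t := by
  suffices h : ∀ i : Fin (L + 1), ‖N.output x i - N'.output x i‖ ≤
      δ * R * ∑ t ∈ Finset.range i, σ ^ t from h (Fin.last L)
  intro i
  induction i using Fin.induction with
  | zero => simp [ReLUNetwork.output, iterateLayers]
  | succ i ih =>
    set y := N.output x i.castSucc
    set y' := N'.output x i.castSucc
    change ‖affineLayer .relu (N.W i) (N.b i) y - affineLayer .relu (N'.W i) (N'.b i) y'‖ ≤ _
    refine (norm_affineLayer_relu_sub_le _ _ _ _ _ _).trans ?_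
    -- The weight difference acts on the output `y` of `N`, so only outputs of `N` need the bound
    -- `R`.
    have h3 : Matrix.toEuclideanLin (N.W i) y + N.b i -
        (Matrix.toEuclideanLin (N'.W i) y' + N'.b i) =
        (Matrix.toEuclideanLin (N.W i) y - Matrix.toEuclideanLin (N'.W i) y) +
          Matrix.toEuclideanLin (N'.W i) (y - y') := by
      rw [hb, map_sub]
      abel
    rw [h3]
    refine (norm_add_le _ _).trans ?_
    have h4 : δ * ‖y‖ ≤ δ * R := mul_le_mul_of_nonneg_left (hR _) hδ
    have h5 := mul_le_mul_of_nonneg_left ih hσ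
    rw [Fin.val_castSucc] at h5
    rw [Fin.val_succ, Finset.sum_range_succ']
    simp only [pow_succ, pow_zero, ← Finset.sum_mul]
    linarith [h1 i y, h2 i (y - y')]

end

theorem mainTheorem7 {n L k : ℕ} (N : ReLUNetwork n L) (hk : k ∣ n)
    (X : Set (CVec n)) (hX : Bornology.IsBounded X) :
    ∃ N' : DCNN n (L * (4 * k + 1)), (∀ i, N'.act i = Activation.relu) ∧
      ∀ R : ℝ, (∀ x ∈ X, ∀ i : Fin (L + 1), ‖N.output x i‖ ≤ R) →
        ∀ x ∈ X, ‖N.eval x - N'.eval x‖ ≤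
          if N.sigmaMax 1 = 1 then (L : ℝ) * R * N.sigmaMax k
          else ((N.sigmaMax 1 ^ L - 1) * R * N.sigmaMax k) / (N.sigmaMax 1 - 1) := by
  -- In width `0`, divisibility does not bound `k`; all singular values are `0`, and so are both
  -- sides.
  obtain rfl | hn := Nat.eq_zero_or_pos n
  · refine ⟨⟨fun _ => 0, fun _ => 0, fun _ => 0, fun _ => .relu, fun _ => Matrix.isDiag_zero,
      fun _ => ⟨0, Subsingleton.elim _ _⟩⟩, fun _ => rfl, fun R _ x _ => ?_⟩
    have h0 : ∀ j, N.sigmaMax j = 0 := fun j => by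
      simp only [ReLUNetwork.sigmaMax, ReLUNetwork.sigma]
      simp [LinearMap.singularValues_of_finrank_le]
    simp [h0, Subsingleton.elim (N.eval x - _) 0]
  · have hk0 : 0 < k := Nat.pos_of_dvd_of_pos hk hn
    choose U V s hU hV h1 h2 using fun i =>
      Matrix.exists_truncated_svd hk0 (Nat.le_of_dvd hn hk) (N.W i)
    let M : ReLUNetwork n L :=
      ⟨fun i => U i * Matrix.diagonal (s i) * (V i).transpose, N.b⟩
    obtain ⟨N', hact, hN'⟩ := M.isDCNNOn_eval (m := 4 * k)
      (fun i => mul_diagonal_mul_transpose_mem_pow hk0 (Nat.le_of_dvd hn hk) (hU i) (hV i) (s i)) hX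
    refine ⟨N', hact, fun R hR x hx => ?_⟩
    have key := N.norm_eval_sub_eval_le M rfl (N.sigmaMax_nonneg k) (N.sigmaMax_nonneg 1)
      (fun i y => (h1 i y).trans (mul_le_mul_of_nonneg_right (N.sigma_le_sigmaMax i k)
        (norm_nonneg y)))
      (fun i y => (h2 i y).trans (mul_le_mul_of_nonneg_right (N.sigma_le_sigmaMax i 1)
        (norm_nonneg y))) x (hR x hx)
    rw [hN' x hx]
    refine key.trans (le_of_eq ?_)
    split_ifs with h
    · rw [h]
      simp
      ring
    · rw [geom_sum_eq h]
      ring
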